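/- Let $n\ge 2$. There are constants $\omega_{k,\ell}^{(m)}=\omega_{k,\ell}^{(m)}(\mathfrak{sl}_n)\in\mathbb{C}$, for $1\le \ell\le k\le n-1$ and $m$ odd with $1\le m\le 2\ell-1$, depending only on $n,k,\ell,m$, with the following property. Let $(E,H,F)$ be any principal $\mathfrak{sl}_2$-triple of $\mathfrak{sl}_n(\mathbb{C})$, that is, $[E,F]=H\neq 0$, $[H,E]=2E$, $[H,F]=-2F$, and the image in $\mathfrak{sl}_n(\mathbb{C})$ of every nonzero nilpotent element of $\mathfrak{sl}_2(\mathbb{C})$ is a nilpotent matrix whose centralizer in $\mathfrak{sl}_n(\mathbb{C})$ has dimension $n-1$. Then the matrices $$G_{i,j}=\operatorname{ad}_F^{\,i-j}(E^i),\qquad 1\le i\le n-1,\quad j\in\{-i,-i+1,\dots,i\},$$ where $E^i$ is the matrix power, form a basis of $\mathfrak{sl}_n(\mathbb{C})$; the linear map $\Phi:\mathfrak{sl}_n(\mathbb{C})\to\mathbb{C}[x,y]$ with $$\Phi(G_{i,j})=m_{i,j}:=y^{i-j}\,\frac{x^{i+j}}{(i+j)!}$$ is injective; and for all basis elements $G_{k,i}$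 and $G_{\ell,j}$ $$\Phi\big([G_{k,i},G_{\ell,j}]\big)=\sum_{\substack{1\le m\le 2\min(k,\ell)-1\\ m\ \mathrm{odd}}}\omega_{\max(k,\ell),\min(k,\ell)}^{(m)}\,\big(m_{k,i},m_{\ell,j}\big)_m .$$ Here the $m$-th transvectant $(P,Q)_m$ of $P,Q\in\mathbb{C}[x,y]$ is obtained by applying the operator $\Omega=\frac{\partial}{\partial x}\otimes\frac{\partial}{\partial y}-\frac{\partial}{\partial y}\otimes\frac{\partial}{\partial x}$ to $P\otimes Q\in\mathbb{C}[x,y]\otimes\mathbb{C}[x,y]$ $m$ times and then applying the multiplication map $\mathbb{C}[x,y]\otimes\mathbb{C}[x,y]\to\mathbb{C}[x,y]$. -/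

import Mathlib

open scoped TensorProduct

noncomputable section

namespace SlTransvectant

/-- The Lie algebra of traceless complex `n × n` matrices. -/
abbrev Sl (n : ℕ) : Type := LieAlgebra.SpecialLinear.sl (Fin n) ℂ

/-- The polynomial ring `ℂ[x, y]`; `x` is the variable `0` and `y` is the variable `1`. -/
abbrev Poly : Type := MvPolynomial (Fin 2) ℂ

/-- A principal nilpotent element: a nilpotent matrix whose centralizer in `sl_n` has the minimal
possible dimension, namely the rank `n - 1` of `sl_n`. -/
def IsPrincipalNilpotent {n : ℕ} (Z : Sl n) : Prop :=
  IsNilpotent (Z : Matrix (Fin n) (Fin n) ℂ) ∧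
    Module.finrank ℂ (LinearMap.ker (LieAlgebra.ad ℂ (Sl n) Z)) = n - 1

/-- `(E, H, F)` is a principal `sl₂`-triple of `sl_n`: the relations `[E, F] = H`, `[H, E] = 2 E`,
`[H, F] = -2 F` hold with `H ≠ 0`, and the image `a E + b H + c F` of every nonzero nilpotent
element `!![b, a; c, -b]` of `sl₂` is principal nilpotent. -/
structure IsPrincipalTriple {n : ℕ} (E H F : Sl n) : Prop where
  triple : IsSl2Triple H E F
  principal : ∀ a b c : ℂ, !![b, a; c, -b] ≠ 0 → IsNilpotent !![b, a; c, -b] →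
    IsPrincipalNilpotent (a • E + b • H + c • F)

/-- The matrix `G_{i,j} = ad_F^{i-j} (E^i)`, where `E^i` is the matrix power. -/
def G {n : ℕ} (E F : Sl n) (i : ℕ) (j : ℤ) : Matrix (Fin n) (Fin n) ℂ :=
  (fun A => ⁅(F : Matrix (Fin n) (Fin n) ℂ), A⁆)^[((i : ℤ) - j).toNat]
    ((E : Matrix (Fin n) (Fin n) ℂ) ^ i)

/-- The index set of the basis: pairs `(i, j)` with `1 ≤ i ≤ n - 1` and `-i ≤ j ≤ i`. -/
abbrev Index (n : ℕ) : Type :=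
  {p : ℕ × ℤ // (1 ≤ p.1 ∧ p.1 < n) ∧ (-(p.1 : ℤ) ≤ p.2 ∧ p.2 ≤ (p.1 : ℤ))}

/-- The monomial `y^{i-j} x^{i+j} / (i+j)!`. -/
def mon (i : ℕ) (j : ℤ) : Poly :=
  MvPolynomial.C ((Nat.factorial ((i : ℤ) + j).toNat : ℂ)⁻¹) *
    (MvPolynomial.X 1 ^ ((i : ℤ) - j).toNat * MvPolynomial.X 0 ^ ((i : ℤ) + j).toNat)

/-- Cayley's operator `Ω = ∂/∂x ⊗ ∂/∂y - ∂/∂y ⊗ ∂/∂x` on `ℂ[x, y] ⊗ ℂ[x, y]`. -/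
def Omega : Module.End ℂ (Poly ⊗[ℂ] Poly) :=
  TensorProduct.map (MvPolynomial.pderiv (R := ℂ) (0 : Fin 2)).toLinearMap
      (MvPolynomial.pderiv (R := ℂ) (1 : Fin 2)).toLinearMap -
    TensorProduct.map (MvPolynomial.pderiv (R := ℂ) (1 : Fin 2)).toLinearMap
      (MvPolynomial.pderiv (R := ℂ) (0 : Fin 2)).toLinearMap

/-- The `m`-th transvectant: apply `Ω` `m` times to `P ⊗ Q`, then multiply. -/
def transvectant (m : ℕ) (P Q : Poly) : Poly :=
  LinearMap.mul' ℂ Poly ((Omega ^ m) (P ⊗ₜ[ℂ] Q))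

/-- The linear dictionary that sends the basis vector with index `(i, j)` to the monomial
`y^{i-j} x^{i+j} / (i+j)!`. -/
def toPoly {n : ℕ} (B : Module.Basis (Index n) ℂ (Sl n)) : Sl n →ₗ[ℂ] Poly :=
  B.constr ℂ (fun p : Index n => mon p.1.1 p.1.2)

end SlTransvectant

end

open scoped TensorProduct

noncomputable section

namespace SlTransvectant

-- Through `ad`, the triple makes `sl_n` an sl₂-module in which `E^k` is a highest weight vector of
-- weight `2k`, while `x ∂/∂y` and `y ∂/∂x` make the binary forms of degree `2k` an sl₂-module. The
-- normalisation `1/(i+j)!` is the one for which Φ carries `ad_E` and `ad_F` to these two operators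
-- (`toPoly_lie_e`, `toPoly_lie_f`). Transvectants are equivariant because Ω is invariant. Both
-- sides of the formula are thus equivariant in the two arguments, and they agree everywhere once
-- they agree on a highest weight vector paired with a lowest one
-- (`toPoly_lie_eq_of_highest_lowest`).
--
-- For that pair, expand `[E^k, ad_F^{2l} E^l]` in the basis. The `H`-weight leaves at most one
-- vector in each summand. Since `ad_E^{2l+1}` kills the bracket, only summands generated by
-- `E^{k+l-m}` with `m ≥ 0` occur. An anti-automorphism sending `E, F` to `-E, -F` forces `m` to be
-- odd. The `m`-th transvectant of the corresponding monomials is a nonzero multiple of the one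
-- monomial allowed, so ω is the quotient of the two coefficients.
--
-- The anti-automorphism, and the fact that ω does not depend on the triple, both come from
-- conjugacy of triples (`IsRegularTriple.exists_conj`). This in turn rests on `E^(n-1) ≠ 0`, which
-- is extracted from the centralizer dimension: small centralizer means small kernel. The basis
-- property follows from distinct eigenvalues of one operator and the count `n² - 1`.

attribute [local instance 100] LieRing.ofAssociativeRing

/-! ### Centralizers of nilpotent endomorphisms. -/

section Centralizer

open Module

variable {K V : Type*} [Field K] [AddCommGroup V] [Module K V]

/-- The space of endomorphisms commuting with `E`. -/
def commutant (E : End K V) : Submodule K (V →ₗ[K] V) :=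
  LinearMap.ker (LinearMap.mulLeft K E - LinearMap.mulRight K E)

theorem mem_commutant {E f : End K V} : f ∈ commutant E ↔ E * f = f * E := by
  simp [commutant, sub_eq_zero]

/-- An endomorphism restricts to an endomorphism of its range. -/
def restrictToRange (E : End K V) : End K (LinearMap.range E) :=
  E.restrict fun x _ => LinearMap.mem_range_self E x

theorem isNilpotent_restrictToRange {E : End K V} (hE : IsNilpotent E) :
    IsNilpotent (restrictToRange E) := by
  obtain ⟨k, hk⟩ := hE
  refine ⟨k, ?_⟩
  rw [restrictToRange, Module.End.pow_restrict]
  ext x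
  simp [hk]

/-- Endomorphisms commuting with the restriction of `E` to its range, together with linear maps
from the cokernel of `E` to its kernel, embed in the centralizer of `E`. -/
theorem exists_injective_centralizer (E : End K V) :
    ∃ Ψ : ((V ⧸ LinearMap.range E) →ₗ[K] LinearMap.ker E) ×
        commutant (restrictToRange E) →ₗ[K]
        commutant E, Function.Injective Ψ := by
  set W := LinearMap.range E with hW
  set E' : End K W := restrictToRange E with hE'
  obtain ⟨s, hs⟩ := E.rangeRestrict.exists_rightInverse_of_surjective E.range_rangeRestrict
  obtain ⟨π, hπ⟩ := W.subtype.exists_leftInverse_of_injective W.ker_subtype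
  have hs' : ∀ w : W, E (s w) = w := fun w => congrArg Subtype.val (LinearMap.congr_fun hs w)
  have hπ' : ∀ w : W, π w = w := fun w => LinearMap.congr_fun hπ w
  have hcomm : ∀ g ∈ commutant E', ∀ w : W, E (g w) = g (E' w) := by
    intro g hg w
    rw [mem_commutant] at hg
    exact congrArg Subtype.val (LinearMap.congr_fun hg w)
  have hEE : ∀ w : W, E' w = E.rangeRestrict w := fun w => rfl
  -- With `s` a section of `E` onto its range and `π` a projection onto it, the last term vanishes
  -- on the range and is the correction that makes `E (Ψ₀ p x) = p.2 (E x)` off the range.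
  let Ψ₀ : ((V ⧸ W) →ₗ[K] LinearMap.ker E) × commutant E' →ₗ[K]
      End K V :=
    { toFun := fun p => (LinearMap.ker E).subtype ∘ₗ p.1 ∘ₗ W.mkQ + W.subtype ∘ₗ p.2.1 ∘ₗ π +
        s ∘ₗ p.2.1 ∘ₗ (E.rangeRestrict - E' ∘ₗ π)
      map_add' := by
        intro p q
        ext x
        simp [LinearMap.add_apply]
        abel
      map_smul' := by
        intro c p
        ext x
        simp }
  have happ : ∀ p x, Ψ₀ p x = p.1 (W.mkQ x) + p.2.1 (π x) +
      s (p.2.1 (E.rangeRestrict x - E' (π x))) := fun p x => rfl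
  have happW : ∀ p (w : W), Ψ₀ p w = p.2.1 w := by
    intro p w
    rw [happ, hπ', (Submodule.Quotient.mk_eq_zero W).2 w.2 |> (fun h => (h : W.mkQ (w : V) = 0)),
      hEE]
    simp
  refine ⟨Ψ₀.codRestrict (commutant E) fun p => ?_, ?_⟩
  · rw [mem_commutant]
    ext x
    have h1 : Ψ₀ p (E x) = p.2.1 (E.rangeRestrict x) := happW p (E.rangeRestrict x)
    simp only [Module.End.mul_apply]
    rw [h1, happ, map_add, map_add, hs', hcomm _ p.2.2, map_sub]
    simp
  · refine (injective_iff_map_eq_zero _).2 fun p hp => ?_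
    replace hp : Ψ₀ p = 0 := congrArg Subtype.val hp
    have h2 : p.2 = 0 := by
      ext w
      have := happW p w
      rw [hp] at this
      simpa using this.symm
    have h1 : p.1 = 0 := by
      ext x
      have := happ p x
      rw [hp, h2] at this
      simpa using this.symm
    exact Prod.ext h1 h2

variable [FiniteDimensional K V]

theorem finrank_prod_commutant {Y : Type*} [AddCommGroup Y] [Module K Y] [FiniteDimensional K Y]
    (E : End K V) :
    finrank K (Y × commutant E) = finrank K Y + finrank K (commutant E) :=
  Module.finrank_prod

theorem finrank_ker_sq_add_finrank_centralizer_restrict_le (E : End K V) :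
    finrank K (LinearMap.ker E) ^ 2 + finrank K (commutant (restrictToRange E)) ≤
      finrank K (commutant E) := by
  obtain ⟨Ψ, hΨ⟩ := exists_injective_centralizer E
  have h := LinearMap.finrank_le_finrank_of_injective hΨ
  rw [finrank_prod_commutant, Module.finrank_linearMap] at h
  have h1 := (LinearMap.range E).finrank_quotient_add_finrank
  have h2 := E.finrank_range_add_finrank_ker
  have h3 : finrank K (V ⧸ LinearMap.range E) = finrank K (LinearMap.ker E) := by omega
  rw [h3] at h
  rw [sq]
  exact h

end Centralizer

/-- Induct by passing to the range of `E`. With `r = dim ker E ≥ 1`, the previous inequality gives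
at least `r² + (d - r) ≥ d`. -/
theorem finrank_le_finrank_centralizer {K : Type*} [Field K] (d : ℕ) :
    ∀ {V : Type*} [AddCommGroup V] [Module K V] [FiniteDimensional K V] (E : Module.End K V),
      Module.finrank K V = d → IsNilpotent E →
      Module.finrank K V ≤ Module.finrank K (commutant E) := by
  induction d using Nat.strong_induction_on with
  | _ d ih =>
  intro V _ _ _ E hd hE
  rcases Nat.eq_zero_or_pos d with h0 | hpos
  · omega
  have h2 := E.finrank_range_add_finrank_ker
  have hker : 0 < Module.finrank K (LinearMap.ker E) := by
    rw [Module.finrank_pos_iff, Submodule.nontrivial_iff_ne_bot]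
    intro hbot
    rw [LinearMap.ker_eq_bot] at hbot
    obtain ⟨k, hk⟩ := hE
    have hinj : Function.Injective (E ^ k) := by
      rw [Module.End.coe_pow]
      exact hbot.iterate k
    have : Nontrivial V := Module.finrank_pos_iff (R := K) |>.1 (by omega)
    obtain ⟨x, hx⟩ := exists_ne (0 : V)
    exact hx (hinj (by simp [hk]))
  have h3 := finrank_ker_sq_add_finrank_centralizer_restrict_le E
  have hnil := isNilpotent_restrictToRange hE
  have h4 := ih _ (by omega) (restrictToRange E) rfl hnil
  nlinarith

section Regular

open Module

variable {K V : Type*} [Field K] [AddCommGroup V] [Module K V] [FiniteDimensional K V]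

/-- A nilpotent endomorphism whose centralizer is minimal has a kernel of dimension at most one. -/
theorem finrank_ker_le_one_of_centralizer {E : End K V} (hE : IsNilpotent E)
    (h : finrank K (commutant E) ≤ finrank K V) :
    finrank K (LinearMap.ker E) ≤ 1 := by
  have h2 := E.finrank_range_add_finrank_ker
  have h3 := finrank_ker_sq_add_finrank_centralizer_restrict_le E
  have hnil := isNilpotent_restrictToRange hE
  have h4 := finrank_le_finrank_centralizer _ (restrictToRange E) rfl hnil
  -- With `r = dim ker E`, the bounds combine to `r² + (dim V - r) ≤ dim V`, so `r² ≤ r`.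
  nlinarith

/-- Each application of `E` to the range of `E^i` loses at most `dim ker E ≤ 1` dimensions. -/
theorem finrank_le_finrank_range_pow_add {E : End K V} (h : finrank K (LinearMap.ker E) ≤ 1)
    (i : ℕ) : finrank K V ≤ finrank K (LinearMap.range (E ^ i)) + i := by
  induction i with
  | zero => rw [pow_zero, Module.End.one_eq_id, LinearMap.range_id, finrank_top, add_zero]
  | succ i ih =>
    have h1 := (E.domRestrict (LinearMap.range (E ^ i))).finrank_range_add_finrank_ker
    have h2 : LinearMap.range (E.domRestrict (LinearMap.range (E ^ i))) =
        LinearMap.range (E ^ (i + 1)) := by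
      rw [LinearMap.range_domRestrict, pow_succ', Module.End.mul_eq_comp, LinearMap.range_comp]
    have h3 : finrank K (LinearMap.ker (E.domRestrict (LinearMap.range (E ^ i)))) ≤
        finrank K (LinearMap.ker E) := by
      rw [LinearMap.ker_domRestrict]
      exact LinearMap.finrank_le_finrank_of_injective
        (f := ((LinearMap.range (E ^ i)).subtype.restrict (p := (LinearMap.ker E).comap
          (LinearMap.range (E ^ i)).subtype) (q := LinearMap.ker E) fun x hx => hx))
        (fun x y hxy => Subtype.ext (Subtype.ext (show (x.1.1 : V) = y.1.1 from
          congrArg (fun z : LinearMap.ker E => (z : V)) hxy)))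
    rw [h2] at h1
    omega

end Regular

open Module in
/-- A principal nilpotent `n × n` matrix has nonzero `(n - 1)`-st power. -/
theorem IsPrincipalNilpotent.pow_ne_zero {n : ℕ} (hn : 1 ≤ n) {Z : Sl n}
    (hZ : IsPrincipalNilpotent Z) : (Z : Matrix (Fin n) (Fin n) ℂ) ^ (n - 1) ≠ 0 := by
  obtain ⟨hnil, hdim⟩ := hZ
  let φ : Matrix (Fin n) (Fin n) ℂ ≃ₐ[ℂ] End ℂ (Fin n → ℂ) := Matrix.toLinAlgEquiv'
  let E : End ℂ (Fin n → ℂ) := φ Z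
  have hE : IsNilpotent E := hnil.map φ
  let C : Submodule ℂ ((Fin n → ℂ) →ₗ[ℂ] (Fin n → ℂ)) := commutant E
  have hC : finrank ℂ C ≤ n := by
    -- The trace cuts the full centralizer down to the one in `sl_n`, of dimension `n - 1`, and its
    -- range accounts for at most one more dimension.
    let t : C →ₗ[ℂ] ℂ := Matrix.traceLinearMap (Fin n) ℂ ℂ ∘ₗ φ.symm.toLinearMap ∘ₗ C.subtype
    have h1 := LinearMap.finrank_range_add_finrank_ker (K := ℂ) (V := C) (V₂ := ℂ) t
    have h2 : finrank ℂ (LinearMap.range t) ≤ 1 := by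
      simpa using (LinearMap.range t).finrank_le
    have htr : ∀ x : LinearMap.ker t, (φ.symm x.1.1).trace = 0 := fun x => x.2
    have hmem : ∀ x : LinearMap.ker t, φ.symm x.1.1 ∈ LieAlgebra.SpecialLinear.sl (Fin n) ℂ :=
      fun x => htr x
    let ψ₀ : LinearMap.ker t →ₗ[ℂ] Sl n :=
      LinearMap.codRestrict (LieAlgebra.SpecialLinear.sl (Fin n) ℂ).toSubmodule
        (φ.symm.toLinearMap ∘ₗ C.subtype ∘ₗ (LinearMap.ker t).subtype) hmem
    have hinj : Function.Injective ψ₀ := fun x y hxy =>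
      Subtype.ext (Subtype.ext (φ.symm.injective (congrArg Subtype.val hxy)))
    have hker : ∀ x, ψ₀ x ∈ LinearMap.ker (LieAlgebra.ad ℂ (Sl n) Z) := by
      intro x
      have hx : E * x.1.1 = x.1.1 * E := mem_commutant.1 x.1.2
      rw [LinearMap.mem_ker, LieAlgebra.ad_apply]
      apply Subtype.ext
      rw [LieAlgebra.SpecialLinear.sl_bracket]
      apply φ.injective
      change φ ((Z : Matrix (Fin n) (Fin n) ℂ) * φ.symm x.1.1 - φ.symm x.1.1 * Z) = φ 0
      rw [map_sub, map_mul, map_mul, AlgEquiv.apply_symm_apply, map_zero, sub_eq_zero]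
      exact hx
    have h3 := LinearMap.finrank_le_finrank_of_injective
      (f := ψ₀.codRestrict _ hker) (fun x y hxy => hinj (congrArg Subtype.val hxy))
    omega
  have h1 := finrank_ker_le_one_of_centralizer hE
    (hC.trans_eq (Module.finrank_fin_fun ℂ).symm)
  have h2 := finrank_le_finrank_range_pow_add h1 (n - 1)
  intro h0
  have h3 : E ^ (n - 1) = 0 := by
    change φ Z ^ (n - 1) = 0
    rw [← map_pow, h0, map_zero]
  rw [h3, LinearMap.range_zero, finrank_bot, Module.finrank_fin_fun] at h2
  omega

/-! ### Regular triples and their conjugacy. -/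

section

open Matrix LieModule

/-- An `sl₂`-triple of `n × n` matrices whose nilpositive element is a single nilpotent Jordan block
up to conjugation. -/
structure IsRegularTriple {n : ℕ} (E H F : Matrix (Fin n) (Fin n) ℂ) : Prop where
  triple : IsSl2Triple H E F
  pow_eq_zero : E ^ n = 0
  pow_ne_zero : E ^ (n - 1) ≠ 0

/-- The characteristic polynomial differs from `X^n` by a nilpotent, hence equals it; then
Cayley–Hamilton. -/
theorem pow_eq_zero_of_isNilpotent {n : ℕ} {E : Matrix (Fin n) (Fin n) ℂ} (hE : IsNilpotent E) :
    E ^ n = 0 := by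
  have h := (Matrix.isNilpotent_charpoly_sub_pow_of_isNilpotent hE).eq_zero
  rw [sub_eq_zero, Fintype.card_fin] at h
  have h2 := Matrix.aeval_self_charpoly E
  rwa [h, map_pow, Polynomial.aeval_X] at h2

theorem IsPrincipalTriple.isRegularTriple {n : ℕ} (hn : 1 ≤ n) {E H F : Sl n}
    (h : IsPrincipalTriple E H F) :
    IsRegularTriple (E : Matrix (Fin n) (Fin n) ℂ) H F := by
  -- Principality at the single nilpotent `!![0, 1; 0, 0]`, whose image is `E`, suffices.
  have hE : IsPrincipalNilpotent E := by
    have := h.principal 1 0 0 (fun h0 => by simpa using congrFun (congrFun h0 0) 1)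
      ⟨2, by ext i j; fin_cases i <;> fin_cases j <;> simp [sq]⟩
    simpa using this
  refine ⟨⟨?_, ?_, ?_, ?_⟩, pow_eq_zero_of_isNilpotent hE.1, hE.pow_ne_zero hn⟩
  · exact fun h0 => h.triple.h_ne_zero (Subtype.ext h0)
  · exact congrArg Subtype.val h.triple.lie_e_f
  · exact congrArg Subtype.val h.triple.lie_h_e_nsmul
  · exact congrArg Subtype.val h.triple.lie_h_f_nsmul

namespace IsRegularTriple

variable {n : ℕ} {E H F E' H' F' : Matrix (Fin n) (Fin n) ℂ}

theorem pos (h : IsRegularTriple E H F) : 0 < n := by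
  rcases Nat.eq_zero_or_pos n with rfl | hn
  · exact absurd (Subsingleton.elim _ _) h.pow_ne_zero
  · exact hn

theorem neg_transpose (h : IsRegularTriple E H F) : IsRegularTriple (-Eᵀ) (-Hᵀ) (-Fᵀ) := by
  obtain ⟨⟨h0, h1, h2, h3⟩, h4, h5⟩ := h
  rw [Ring.lie_def] at h1 h2 h3
  refine ⟨⟨?_, ?_, ?_, ?_⟩, ?_, ?_⟩
  · simpa using h0
  · rw [Ring.lie_def, ← h1]
    simp
  · rw [Ring.lie_def, ← transpose_neg, ← transpose_neg, ← transpose_mul, ← transpose_mul,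
      ← transpose_sub, ← transpose_smul]
    congr 1
    rw [smul_neg, ← h2]
    noncomm_ring
  · rw [Ring.lie_def, ← transpose_neg, ← transpose_neg, ← transpose_mul, ← transpose_mul,
      ← transpose_sub, ← transpose_smul, ← transpose_neg]
    congr 1
    rw [smul_neg, ← h3]
    noncomm_ring
  · rw [neg_pow, ← transpose_pow, h4]
    simp
  · rw [neg_pow, ← transpose_pow]
    intro h
    apply h5
    rcases neg_one_pow_eq_or (Matrix (Fin n) (Fin n) ℂ) (n - 1) with h6 | h6 <;>
      simpa [h6, -transpose_pow] using h

end IsRegularTriple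

section Ring

variable {A : Type*} [Ring A] [Algebra ℂ A] {E H F : A}

theorem lie_pow_succ (h : IsSl2Triple H E F) (m : ℕ) :
    E ^ (m + 1) * F - F * E ^ (m + 1) = ((m : ℂ) + 1) • ((H - algebraMap ℂ A m) * E ^ m) := by
  have h1 := h.lie_e_f
  have h2 := h.lie_h_e_nsmul
  rw [Ring.lie_def] at h1 h2
  induction m with
  | zero => simpa using h1
  | succ m ih =>
    have h3 : E ^ (m + 2) * F - F * E ^ (m + 2) =
        E * (E ^ (m + 1) * F - F * E ^ (m + 1)) + (E * F - F * E) * E ^ (m + 1) := by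
      rw [pow_succ' E (m + 1)]
      noncomm_ring
    have h4 : E * H = H * E - 2 • E := by
      rw [← h2]
      abel
    rw [h3, ih, h1, mul_smul_comm, ← mul_assoc, mul_sub, h4, Algebra.algebraMap_eq_smul_one,
      Algebra.algebraMap_eq_smul_one, mul_smul_comm, mul_one, two_nsmul]
    simp only [sub_mul, add_mul, smul_mul_assoc, one_mul, mul_assoc, ← pow_succ']
    push_cast
    module

theorem lie_pow (h : IsSl2Triple H E F) (m : ℕ) :
    ⁅H, E ^ m⁆ = (2 * m : ℂ) • E ^ m := by
  have h2 := h.lie_h_e_nsmul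
  rw [Ring.lie_def] at h2 ⊢
  induction m with
  | zero => simp
  | succ m ih =>
    have h3 : H * E ^ (m + 1) - E ^ (m + 1) * H =
        (H * E ^ m - E ^ m * H) * E + E ^ m * (H * E - E * H) := by
      rw [pow_succ]
      noncomm_ring
    rw [h3, ih, h2, smul_mul_assoc, mul_smul_comm, ← pow_succ, two_nsmul]
    push_cast
    module

end Ring

namespace IsRegularTriple

variable {n : ℕ} {E H F E' H' F' : Matrix (Fin n) (Fin n) ℂ}

/-- The standard basis of the irreducible representation defined by a regular triple. -/
theorem exists_basis (h : IsRegularTriple E H F) :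
    ∃ (w : ℕ → Fin n → ℂ) (b : Module.Basis (Fin n) ℂ (Fin n → ℂ)), (∀ i : Fin n, b i = w i) ∧
      w n = 0 ∧ (∀ i, F *ᵥ w i = w (i + 1)) ∧ E *ᵥ w 0 = 0 ∧
      ∀ i : ℕ, E *ᵥ w (i + 1) = (((i : ℂ) + 1) * ((n - 1 : ℕ) - i)) • w i := by
  have hn := h.pos
  obtain ⟨u, hu⟩ : ∃ u, E ^ (n - 1) *ᵥ u ≠ 0 := by
    by_contra! hu
    exact h.pow_ne_zero (Matrix.ext_of_mulVec_single fun i => by rw [hu, zero_mulVec])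
  have hE : E *ᵥ (E ^ (n - 1) *ᵥ u) = 0 := by
    rw [mulVec_mulVec, ← pow_succ', Nat.sub_add_cancel hn, h.pow_eq_zero, zero_mulVec]
  -- As `E^n = 0`, the commutator formula for `[E^n, F]` reads `0 = n (H - (n - 1)) E^(n-1)`, which
  -- identifies the weight.
  have hH : H *ᵥ (E ^ (n - 1) *ᵥ u) = ((n - 1 : ℕ) : ℂ) • (E ^ (n - 1) *ᵥ u) := by
    have h1 := lie_pow_succ h.triple (n - 1)
    rw [Nat.sub_add_cancel hn, h.pow_eq_zero, zero_mul, mul_zero, sub_zero, eq_comm,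
      smul_eq_zero, or_iff_right (Nat.cast_add_one_ne_zero _), sub_mul, sub_eq_zero] at h1
    rw [mulVec_mulVec, h1, ← Algebra.smul_def, smul_mulVec]
  have P : h.triple.HasPrimitiveVectorWith (E ^ (n - 1) *ᵥ u) ((n - 1 : ℕ) : ℂ) :=
    ⟨hu, hH, hE⟩
  let w : ℕ → Fin n → ℂ := fun i =>
    (toEnd ℂ (Matrix (Fin n) (Fin n) ℂ) (Fin n → ℂ) F ^ i) (E ^ (n - 1) *ᵥ u)
  have hli : LinearIndependent ℂ (fun i : Fin n => w i) := by
    refine Module.End.eigenvectors_linearIndependent'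
      (toEnd ℂ (Matrix (Fin n) (Fin n) ℂ) (Fin n → ℂ) H)
      (fun i : Fin n => ((n - 1 : ℕ) : ℂ) - 2 * (i : ℕ)) ?_ _ ?_
    · intro i j hij
      apply Fin.ext
      simpa using hij
    · intro i
      rw [Module.End.hasEigenvector_iff, Module.End.mem_eigenspace_iff]
      exact ⟨P.lie_h_pow_toEnd_f i, P.pow_toEnd_f_ne_zero_of_eq_nat rfl (by omega)⟩
  have : Nonempty (Fin n) := ⟨⟨0, hn⟩⟩
  refine ⟨w, basisOfLinearIndependentOfCardEqFinrank hli (by simp), fun i => by simp, ?_, ?_, ?_,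
    ?_⟩
  · have h1 := P.pow_toEnd_f_eq_zero_of_eq_nat rfl
    rwa [Nat.sub_add_cancel hn] at h1
  · exact fun i => P.lie_f_pow_toEnd_f i
  · exact P.lie_e
  · exact fun i => P.lie_e_pow_succ_toEnd_f i

/-- Any two regular triples are conjugate. -/
theorem exists_conj (h : IsRegularTriple E H F) (h' : IsRegularTriple E' H' F') :
    ∃ P : (Matrix (Fin n) (Fin n) ℂ)ˣ, SemiconjBy (P : Matrix (Fin n) (Fin n) ℂ) E E' ∧
      SemiconjBy (P : Matrix (Fin n) (Fin n) ℂ) F F' := by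
  have hn := h.pos
  obtain ⟨w, b, hb, hw, hF, hE0, hE⟩ := h.exists_basis
  obtain ⟨w', b', hb', hw', hF', hE0', hE'⟩ := h'.exists_basis
  let g : (Fin n → ℂ) ≃ₗ[ℂ] (Fin n → ℂ) := b.equiv b' (Equiv.refl _)
  have hg : ∀ i ≤ n, g (w i) = w' i := by
    intro i hi
    rcases hi.lt_or_eq with hi | rfl
    · have h1 := b.equiv_apply ⟨i, hi⟩ b' (Equiv.refl _)
      rwa [hb, Equiv.refl_apply, hb'] at h1
    · rw [hw, hw', map_zero]
  have key : ∀ {X X' : Matrix (Fin n) (Fin n) ℂ},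
      (∀ i < n, g (X *ᵥ w i) = X' *ᵥ w' i) →
      LinearMap.toMatrix' g.toLinearMap * X = X' * LinearMap.toMatrix' g.toLinearMap := by
    intro X X' hX
    have h1 : g.toLinearMap ∘ₗ Matrix.toLin' X = Matrix.toLin' X' ∘ₗ g.toLinearMap := by
      refine b.ext fun i => ?_
      rw [LinearMap.comp_apply, LinearMap.comp_apply, Matrix.toLin'_apply, Matrix.toLin'_apply, hb,
        LinearEquiv.coe_coe, hX i i.2, hg i i.2.le]
    have h2 := congrArg LinearMap.toMatrix' h1
    rwa [LinearMap.toMatrix'_comp, LinearMap.toMatrix'_comp, LinearMap.toMatrix'_toLin',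
      LinearMap.toMatrix'_toLin'] at h2
  refine ⟨⟨LinearMap.toMatrix' g.toLinearMap, LinearMap.toMatrix' g.symm.toLinearMap, ?_, ?_⟩,
    key ?_, key ?_⟩
  · rw [← LinearMap.toMatrix'_comp, LinearEquiv.comp_symm, LinearMap.toMatrix'_id]
  · rw [← LinearMap.toMatrix'_comp, LinearEquiv.symm_comp, LinearMap.toMatrix'_id]
  · rintro (_ | i) hi
    · rw [hE0, hE0', map_zero]
    · rw [hE, hE', map_smul, hg i (by omega)]
  · intro i hi
    rw [hF, hF', hg (i + 1) hi]

end IsRegularTriple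

end

/-! ### The vectors `ad_F^a (E^k)` and the basis of `sl_n`. -/

section

open Matrix LieModule

/-- The vector `ad_F^a (E^k)`. -/
def lowered {A : Type*} [Ring A] [Algebra ℂ A] (E F : A) (k a : ℕ) : A :=
  (toEnd ℂ A A F ^ a) (E ^ k)

theorem lie_self_pow {A : Type*} [Ring A] (E : A) (k : ℕ) : ⁅E, E ^ k⁆ = 0 := by
  rw [Ring.lie_def, ← pow_succ, ← pow_succ', sub_self]

section Lowered

variable {A : Type*} [Ring A] [Algebra ℂ A]

theorem lowered_zero (E F : A) (k : ℕ) : lowered E F k 0 = E ^ k := rfl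

theorem lie_lowered (E F : A) (k a : ℕ) : ⁅F, lowered E F k a⁆ = lowered E F k (a + 1) := by
  simp [lowered, pow_succ']

theorem pow_toEnd_lowered (E F : A) (k a N : ℕ) :
    (toEnd ℂ A A F ^ N) (lowered E F k a) = lowered E F k (a + N) := by
  rw [lowered, lowered, add_comm, pow_add, Module.End.mul_apply]

theorem lowered_of_pow_eq_zero {E F : A} {k : ℕ} (h : E ^ k = 0) (a : ℕ) :
    lowered E F k a = 0 := by
  rw [lowered, h, map_zero]

theorem G_eq_lowered {n : ℕ} (E F : Sl n) (i : ℕ) (j : ℤ) :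
    G E F i j = lowered (E : Matrix (Fin n) (Fin n) ℂ) F i ((i : ℤ) - j).toNat := by
  rw [G, lowered, Module.End.pow_apply]
  rfl

variable {E H F : A} (h : IsSl2Triple H E F) {k : ℕ}
include h

/-- Gives access to the standard sl₂ formulas. Primitive vectors are nonzero, which is why the
lemmas below treat `E ^ k = 0` separately. -/
theorem hasPrimitiveVectorWith_pow (hk : E ^ k ≠ 0) :
    h.HasPrimitiveVectorWith (E ^ k) ((2 * k : ℕ) : ℂ) :=
  ⟨hk, by rw [lie_pow h]; push_cast; rfl, lie_self_pow E k⟩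

theorem lie_h_lowered (a : ℕ) :
    ⁅H, lowered E F k a⁆ = (2 * k - 2 * a : ℂ) • lowered E F k a := by
  by_cases hk : E ^ k = 0
  · rw [lowered_of_pow_eq_zero hk, lie_zero, smul_zero]
  · have := (hasPrimitiveVectorWith_pow h hk).lie_h_pow_toEnd_f a
    push_cast at this
    exact this

theorem lie_e_lowered_succ (a : ℕ) :
    ⁅E, lowered E F k (a + 1)⁆ = (((a : ℂ) + 1) * (2 * k - a)) • lowered E F k a := by
  by_cases hk : E ^ k = 0
  · rw [lowered_of_pow_eq_zero hk, lowered_of_pow_eq_zero hk, lie_zero, smul_zero]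
  · have := (hasPrimitiveVectorWith_pow h hk).lie_e_pow_succ_toEnd_f a
    push_cast at this
    exact this

theorem lie_f_lie_e_lowered (a : ℕ) :
    ⁅F, ⁅E, lowered E F k a⁆⁆ = ((a : ℂ) * (2 * k - a + 1)) • lowered E F k a := by
  rcases a with _ | a
  · rw [lowered_zero, lie_self_pow]
    simp
  · rw [lie_e_lowered_succ h, lie_smul, lie_lowered]
    push_cast
    ring_nf

theorem lowered_ne_zero (hk : E ^ k ≠ 0) {a : ℕ} (ha : a ≤ 2 * k) : lowered E F k a ≠ 0 :=
  (hasPrimitiveVectorWith_pow h hk).pow_toEnd_f_ne_zero_of_eq_nat rfl ha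

theorem lowered_eq_zero [FiniteDimensional ℂ A] : lowered E F k (2 * k + 1) = 0 := by
  by_cases hk : E ^ k = 0
  · exact lowered_of_pow_eq_zero hk _
  · exact (hasPrimitiveVectorWith_pow h hk).pow_toEnd_f_eq_zero_of_eq_nat rfl

theorem lowered_eq_zero_of_lt [FiniteDimensional ℂ A] {a : ℕ} (ha : 2 * k < a) :
    lowered E F k a = 0 := by
  obtain ⟨b, rfl⟩ := Nat.exists_eq_add_of_le ha
  rw [← pow_toEnd_lowered, Nat.succ_eq_add_one, lowered_eq_zero h, map_zero]

/-- The scalar is a product of factors `(b + 1)(2k - b)`, nonzero until the top of the string is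
passed; for `N > a` it is `0`, so the truncated `a - N` is harmless. -/
theorem exists_pow_toEnd_e_lowered (k a N : ℕ) (ha : a ≤ 2 * k) :
    ∃ c : ℂ, (toEnd ℂ A A E ^ N) (lowered E F k a) = c • lowered E F k (a - N) ∧
      (c ≠ 0 ↔ N ≤ a) := by
  induction N with
  | zero => exact ⟨1, by simp⟩
  | succ N ih =>
    obtain ⟨c, hc, hc'⟩ := ih
    rw [pow_succ', Module.End.mul_apply, hc, map_smul, toEnd_apply_apply]
    rcases Nat.lt_or_ge N a with hN | hN
    · obtain ⟨b, rfl⟩ := Nat.exists_eq_add_of_lt hN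
      refine ⟨c * (((b : ℂ) + 1) * (2 * k - b)), ?_, ?_⟩
      · rw [show N + b + 1 - N = b + 1 by omega, show N + b + 1 - (N + 1) = b by omega,
          lie_e_lowered_succ h, smul_smul]
      · refine iff_of_true (mul_ne_zero (hc'.2 hN.le) (mul_ne_zero (Nat.cast_add_one_ne_zero b)
          (sub_ne_zero.2 ?_))) hN
        norm_cast
        omega
    · refine ⟨0, ?_, iff_of_false (by simp) (by omega)⟩
      rw [Nat.sub_eq_zero_of_le hN, lowered_zero, lie_self_pow, smul_zero, zero_smul]

/-- Combining lowering and raising gives a diagonal operator. -/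
theorem exists_pow_toEnd_f_pow_toEnd_e_lowered (k a N : ℕ) (ha : a ≤ 2 * k) :
    ∃ c : ℂ, (toEnd ℂ A A F ^ N * toEnd ℂ A A E ^ N) (lowered E F k a) = c • lowered E F k a ∧
      (N ≤ a → c ≠ 0) := by
  obtain ⟨c, hc, hc'⟩ := exists_pow_toEnd_e_lowered h k a N ha
  refine ⟨c, ?_, hc'.2⟩
  rw [Module.End.mul_apply, hc, map_smul, pow_toEnd_lowered]
  by_cases hN : N ≤ a
  · rw [Nat.sub_add_cancel hN]
  · rw [not_not.1 (mt hc'.1 hN), zero_smul, zero_smul]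

end Lowered

section Index

variable {n : ℕ}

/-- The index of the basis vector `ad_F^a (E^k)`. -/
def idx (k a : ℕ) (hk : 1 ≤ k ∧ k < n) (ha : a ≤ 2 * k) : Index n :=
  ⟨(k, (k : ℤ) - a), hk, by omega, by omega⟩

/-- The number of times `ad_F` is applied in the basis vector with a given index. -/
def depth (p : Index n) : ℕ := ((p.1.1 : ℤ) - p.1.2).toNat

theorem cast_depth (p : Index n) : (depth p : ℤ) = p.1.1 - p.1.2 :=
  Int.toNat_of_nonneg (by have := p.2.2.2; omega)

theorem depth_le (p : Index n) : depth p ≤ 2 * p.1.1 := by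
  have := cast_depth p
  have := p.2.2.1
  omega

theorem depth_idx (k a : ℕ) (hk : 1 ≤ k ∧ k < n) (ha : a ≤ 2 * k) : depth (idx k a hk ha) = a := by
  simp [depth, idx]

theorem index_ext {p q : Index n} (h1 : p.1.1 = q.1.1) (h2 : depth p = depth q) : p = q := by
  have hp := cast_depth p
  have hq := cast_depth q
  refine Subtype.ext (Prod.ext h1 ?_)
  omega

/-- The elements of `Index n`, listed by their first component. -/
def indexFinset (n : ℕ) : Finset (ℕ × ℤ) :=
  (Finset.Ico 1 n).biUnion fun i => {i} ×ˢ Finset.Icc (-(i : ℤ)) i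

theorem mem_indexFinset (p : ℕ × ℤ) :
    p ∈ indexFinset n ↔ (1 ≤ p.1 ∧ p.1 < n) ∧ (-(p.1 : ℤ) ≤ p.2 ∧ p.2 ≤ (p.1 : ℤ)) := by
  obtain ⟨i, j⟩ := p
  simp only [indexFinset, Finset.mem_biUnion, Finset.mem_product, Finset.mem_singleton,
    Finset.mem_Ico, Finset.mem_Icc]
  constructor
  · rintro ⟨_, h1, rfl, h2⟩
    exact ⟨h1, h2⟩
  · exact fun h => ⟨i, h.1, rfl, h.2⟩

instance : Fintype (Index n) := Fintype.subtype (indexFinset n) mem_indexFinset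

theorem card_index (hn : 1 ≤ n) : Fintype.card (Index n) + 1 = n ^ 2 := by
  rw [Fintype.card_of_subtype (indexFinset n) mem_indexFinset, indexFinset,
    Finset.card_biUnion]
  · simp only [Finset.card_product, Finset.card_singleton, one_mul, Int.card_Icc]
    induction n, hn using Nat.le_induction with
    | base => simp
    | succ n hn ih =>
      rw [Finset.sum_Ico_succ_top hn]
      have : ((n : ℤ) + 1 - -(n : ℤ)).toNat = 2 * n + 1 := by omega
      rw [this]
      nlinarith
  · intro i _ j _ hij
    rw [Function.onFun, Finset.disjoint_product]
    simp [hij]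

end Index

namespace IsRegularTriple

variable {n : ℕ} {E H F : Matrix (Fin n) (Fin n) ℂ}

theorem pow_ne_zero_of_lt (h : IsRegularTriple E H F) {k : ℕ} (hk : k < n) : E ^ k ≠ 0 := by
  intro h0
  apply h.pow_ne_zero
  rw [← Nat.add_sub_of_le (Nat.le_sub_one_of_lt hk), pow_add, h0, zero_mul]

theorem linearIndependent (h : IsRegularTriple E H F) :
    LinearIndependent ℂ (fun p : Index n => lowered E F p.1.1 (depth p)) := by
  -- The bracketed Casimir operator has eigenvalue `i(i+1)` and `H/2` has eigenvalue `j`. Since `|j|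
  -- < n`, the factor `2n` keeps the eigenvalues `2n·i(i+1) + j` distinct.
  let T : Module.End ℂ (Matrix (Fin n) (Fin n) ℂ) :=
    (2 * n : ℂ) • (toEnd ℂ _ _ F * toEnd ℂ _ _ E + (1 / 4 : ℂ) • toEnd ℂ _ _ H ^ 2 +
      (1 / 2 : ℂ) • toEnd ℂ _ _ H) + (1 / 2 : ℂ) • toEnd ℂ _ _ H
  refine Module.End.eigenvectors_linearIndependent' T
    (fun p => ((2 * n * (p.1.1 * (p.1.1 + 1)) + p.1.2 : ℤ) : ℂ)) ?_ _ ?_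
  · intro p q hpq
    replace hpq : (2 * n * (p.1.1 * (p.1.1 + 1)) + p.1.2 : ℤ) =
      2 * n * (q.1.1 * (q.1.1 + 1)) + q.1.2 := by
      beta_reduce at hpq
      exact_mod_cast hpq
    obtain ⟨⟨i, j⟩, ⟨hi, hi'⟩, hj, hj'⟩ := p
    obtain ⟨⟨k, l⟩, ⟨hk, hk'⟩, hl, hl'⟩ := q
    simp only at *
    have hik : i = k := by
      rcases lt_trichotomy i k with hlt | heq | hlt
      · exfalso
        have h1 : (i : ℤ) * (i + 1) + 1 ≤ k * (k + 1) := by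
          have : (i : ℤ) + 1 ≤ k := by exact_mod_cast hlt
          nlinarith
        have h2 : (2 * n : ℤ) * (i * (i + 1) + 1) ≤ 2 * n * (k * (k + 1)) :=
          mul_le_mul_of_nonneg_left h1 (by positivity)
        rw [mul_add (2 * n : ℤ)] at h2
        omega
      · exact heq
      · exfalso
        have h1 : (k : ℤ) * (k + 1) + 1 ≤ i * (i + 1) := by
          have : (k : ℤ) + 1 ≤ i := by exact_mod_cast hlt
          nlinarith
        have h2 : (2 * n : ℤ) * (k * (k + 1) + 1) ≤ 2 * n * (i * (i + 1)) :=
          mul_le_mul_of_nonneg_left h1 (by positivity)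
        rw [mul_add (2 * n : ℤ)] at h2
        omega
    subst hik
    have : j = l := by omega
    subst this
    rfl
  · intro p
    rw [Module.End.hasEigenvector_iff, Module.End.mem_eigenspace_iff]
    refine ⟨?_, lowered_ne_zero h.triple (h.pow_ne_zero_of_lt p.2.1.2) (depth_le p)⟩
    have hd : (p.1.2 : ℂ) = (p.1.1 : ℂ) - depth p := by
      have : p.1.2 = (p.1.1 : ℤ) - depth p := by
        have := cast_depth p
        omega
      rw [this]
      push_cast
      rfl
    simp only [T, LinearMap.add_apply, LinearMap.smul_apply, Module.End.mul_apply, sq,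
      toEnd_apply_apply, lie_f_lie_e_lowered h.triple, lie_h_lowered h.triple, lie_smul]
    push_cast
    rw [hd]
    module

end IsRegularTriple

theorem trace_pow_eq_zero {n : ℕ} {E : Matrix (Fin n) (Fin n) ℂ} (hE : IsNilpotent E) {k : ℕ}
    (hk : 1 ≤ k) : (E ^ k).trace = 0 :=
  (Matrix.isNilpotent_trace_of_isNilpotent (hE.pow_of_pos (by omega))).eq_zero

theorem trace_lowered {n : ℕ} {E F : Matrix (Fin n) (Fin n) ℂ} (hE : IsNilpotent E) {k : ℕ}
    (hk : 1 ≤ k) (a : ℕ) : (lowered E F k a).trace = 0 := by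
  rcases a with _ | a
  · exact trace_pow_eq_zero hE hk
  · rw [← lie_lowered]
    exact LieAlgebra.matrix_trace_commutator_zero _ _ _ _

/-- The identity matrix is not traceless. The strict bound is enough, because `n² - 1` independent
vectors are already at hand. -/
theorem finrank_sl_lt {n : ℕ} (hn : 1 ≤ n) : Module.finrank ℂ (Sl n) < n ^ 2 := by
  have h1 : (LieAlgebra.SpecialLinear.sl (Fin n) ℂ).toSubmodule < ⊤ := by
    refine lt_top_iff_ne_top.2 fun h => ?_
    have : (1 : Matrix (Fin n) (Fin n) ℂ) ∈ (LieAlgebra.SpecialLinear.sl (Fin n) ℂ).toSubmodule :=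
      h ▸ Submodule.mem_top
    have h2 : (1 : Matrix (Fin n) (Fin n) ℂ).trace = 0 := this
    rw [Matrix.trace_one, Fintype.card_fin, Nat.cast_eq_zero] at h2
    omega
  have h2 := Submodule.finrank_lt h1.ne
  rw [Module.finrank_matrix, Fintype.card_fin, Module.finrank_self, mul_one, ← sq] at h2
  exact h2

/-- The vectors `ad_F^a (E^k)` with `1 ≤ k < n` and `a ≤ 2k` form a basis of `sl_n`. -/
theorem exists_basis_sl {n : ℕ} {E H F : Matrix (Fin n) (Fin n) ℂ} (h : IsRegularTriple E H F) :
    ∃ B : Module.Basis (Index n) ℂ (Sl n),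
      ∀ p, (B p : Matrix (Fin n) (Fin n) ℂ) = lowered E F p.1.1 (depth p) := by
  have hn := h.pos
  let v : Index n → Sl n := fun p => ⟨lowered E F p.1.1 (depth p),
    trace_lowered ⟨n, h.pow_eq_zero⟩ p.2.1.1 _⟩
  have hv : LinearIndependent ℂ v :=
    LinearIndependent.of_comp (LieAlgebra.SpecialLinear.sl (Fin n) ℂ).toSubmodule.subtype
      h.linearIndependent
  have h1 := hv.fintype_card_le_finrank
  have h2 := finrank_sl_lt hn
  have h3 := card_index hn
  refine ⟨Module.Basis.mk hv (hv.span_eq_top_of_card_eq_finrank' (by omega)).ge, fun p => ?_⟩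
  rw [Module.Basis.mk_apply]

end

/-! ### The bracket of a highest and a lowest weight vector. -/

section

open Matrix LieModule

/-- If a family of independent vectors diagonalises `T`, then an eigenvector of `T` only involves
the vectors with the same eigenvalue. -/
theorem eigenvalue_eq_of_coeff_ne_zero {ι V : Type*} [Fintype ι] [AddCommGroup V] [Module ℂ V]
    {v : ι → V} (hv : LinearIndependent ℂ v) {T : Module.End ℂ V} {t : ι → ℂ} {s : ℂ} {x : ι → ℂ}
    (ht : ∀ i, T (v i) = t i • v i) (hx : T (∑ i, x i • v i) = s • ∑ i, x i • v i) {i : ι}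
    (hi : x i ≠ 0) : t i = s := by
  have h1 : ∑ i, (x i * (t i - s)) • v i = 0 := by
    rw [map_sum, Finset.smul_sum, ← sub_eq_zero, ← Finset.sum_sub_distrib] at hx
    rw [← hx]
    refine Finset.sum_congr rfl fun i _ => ?_
    rw [map_smul, ht]
    module
  have h2 := Fintype.linearIndependent_iff.1 hv _ h1 i
  exact sub_eq_zero.1 ((mul_eq_zero.1 h2).resolve_left hi)

section Conj

variable {n : ℕ} {E F E' F' P : Matrix (Fin n) (Fin n) ℂ}

theorem semiconjBy_lie {X Y X' Y' : Matrix (Fin n) (Fin n) ℂ} (h : SemiconjBy P X X')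
    (h' : SemiconjBy P Y Y') : SemiconjBy P ⁅X, Y⁆ ⁅X', Y'⁆ := by
  rw [Ring.lie_def, Ring.lie_def]
  exact (h.mul_right h').sub_right (h'.mul_right h)

theorem semiconjBy_lowered (hE : SemiconjBy P E E') (hF : SemiconjBy P F F') (k a : ℕ) :
    SemiconjBy P (lowered E F k a) (lowered E' F' k a) := by
  induction a with
  | zero => exact hE.pow_right k
  | succ a ih =>
    rw [← lie_lowered, ← lie_lowered]
    exact semiconjBy_lie hF ih

/-- Transposition reverses brackets and `F` changes sign; the two signs cancel, so the result does
not depend on `a`. -/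
theorem lowered_neg_transpose (E F : Matrix (Fin n) (Fin n) ℂ) (k a : ℕ) :
    lowered (-Eᵀ) (-Fᵀ) k a = (-1 : ℂ) ^ k • (lowered E F k a)ᵀ := by
  induction a with
  | zero =>
    rw [lowered_zero, lowered_zero, transpose_pow, ← neg_one_smul ℂ Eᵀ, smul_pow]
  | succ a ih =>
    rw [← lie_lowered, ← lie_lowered, ih, lie_smul, Ring.lie_def, Ring.lie_def, transpose_sub,
      transpose_mul, transpose_mul]
    congr 1
    noncomm_ring

/-- The linear map `A ↦ (P A P⁻¹)ᵀ`. -/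
def conjTranspose (P : (Matrix (Fin n) (Fin n) ℂ)ˣ) : Module.End ℂ (Matrix (Fin n) (Fin n) ℂ) :=
  (Matrix.transposeLinearEquiv (Fin n) (Fin n) ℂ ℂ).toLinearMap ∘ₗ
    LinearMap.mulRight ℂ (↑P⁻¹ : Matrix (Fin n) (Fin n) ℂ) ∘ₗ
      LinearMap.mulLeft ℂ (P : Matrix (Fin n) (Fin n) ℂ)

theorem conjTranspose_apply (P : (Matrix (Fin n) (Fin n) ℂ)ˣ) {A A' : Matrix (Fin n) (Fin n) ℂ}
    (h : SemiconjBy (P : Matrix (Fin n) (Fin n) ℂ) A A') : conjTranspose P A = A'ᵀ := by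
  have h' : (P : Matrix (Fin n) (Fin n) ℂ) * A = A' * P := h
  change ((P : Matrix (Fin n) (Fin n) ℂ) * A * (↑P⁻¹ : Matrix (Fin n) (Fin n) ℂ))ᵀ = A'ᵀ
  rw [h', Units.mul_inv_cancel_right]

theorem conjTranspose_lowered (P : (Matrix (Fin n) (Fin n) ℂ)ˣ)
    (hE : SemiconjBy (P : Matrix (Fin n) (Fin n) ℂ) E (-Eᵀ))
    (hF : SemiconjBy (P : Matrix (Fin n) (Fin n) ℂ) F (-Fᵀ)) (k a : ℕ) :
    conjTranspose P (lowered E F k a) = (-1 : ℂ) ^ k • lowered E F k a := by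
  rw [conjTranspose_apply P (semiconjBy_lowered hE hF k a), lowered_neg_transpose, transpose_smul,
    transpose_transpose]

/-- The extra sign compared with single vectors arises because the map is an anti-automorphism; it
is the source of the odd degrees. -/
theorem conjTranspose_lie_lowered (P : (Matrix (Fin n) (Fin n) ℂ)ˣ)
    (hE : SemiconjBy (P : Matrix (Fin n) (Fin n) ℂ) E (-Eᵀ))
    (hF : SemiconjBy (P : Matrix (Fin n) (Fin n) ℂ) F (-Fᵀ)) (k a l b : ℕ) :
    conjTranspose P ⁅lowered E F k a, lowered E F l b⁆ =
      (-1 : ℂ) ^ (k + l + 1) • ⁅lowered E F k a, lowered E F l b⁆ := by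
  rw [conjTranspose_apply P (semiconjBy_lie (semiconjBy_lowered hE hF k a)
    (semiconjBy_lowered hE hF l b)), lowered_neg_transpose, lowered_neg_transpose, lie_smul,
    smul_lie, Ring.lie_def, Ring.lie_def, transpose_smul, transpose_smul, transpose_sub,
    transpose_mul, transpose_mul, transpose_transpose, transpose_transpose, smul_smul, pow_succ,
    pow_add, mul_neg_one, neg_smul, ← smul_neg, neg_sub, mul_comm]

end Conj

theorem toEnd_pow_lie_of_lie_eq_zero {L : Type*} [LieRing L] [LieAlgebra ℂ L] {E X : L}
    (h : ⁅E, X⁆ = 0) (Y : L) (N : ℕ) :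
    (toEnd ℂ L L E ^ N) ⁅X, Y⁆ = ⁅X, (toEnd ℂ L L E ^ N) Y⁆ := by
  induction N with
  | zero => rfl
  | succ N ih =>
    rw [pow_succ', Module.End.mul_apply, Module.End.mul_apply, ih, toEnd_apply_apply,
      toEnd_apply_apply, leibniz_lie, h, zero_lie, zero_add]

theorem pow_toEnd_e_lowered_eq_zero {A : Type*} [Ring A] [Algebra ℂ A] {E H F : A}
    (h : IsSl2Triple H E F) {k a N : ℕ} (ha : a ≤ 2 * k) (hN : a < N) :
    (toEnd ℂ A A E ^ N) (lowered E F k a) = 0 := by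
  obtain ⟨c, hc, hc'⟩ := exists_pow_toEnd_e_lowered h k a N ha
  rw [hc, not_not.1 (mt hc'.1 (by omega)), zero_smul]

/-- The odd degrees that occur in the bracket of two basis vectors. -/
def oddDegrees (l : ℕ) : Finset ℕ := (Finset.Icc 1 (2 * l - 1)).filter fun m => Odd m

theorem mem_oddDegrees {l m : ℕ} : m ∈ oddDegrees l ↔ (1 ≤ m ∧ m ≤ 2 * l - 1) ∧ Odd m := by
  rw [oddDegrees, Finset.mem_filter, Finset.mem_Icc]

/-- The bracket of a highest and a lowest weight vector in terms of the basis. -/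
theorem IsRegularTriple.exists_lie_highest_lowest {n : ℕ} {E H F : Matrix (Fin n) (Fin n) ℂ}
    (h : IsRegularTriple E H F) {k l : ℕ} (hl : 1 ≤ l) (hlk : l ≤ k) :
    ∃ c : ℕ → ℂ, (∀ m ∈ oddDegrees l, n ≤ k + l - m → c m = 0) ∧
      ⁅lowered E F k 0, lowered E F l (2 * l)⁆ =
        ∑ m ∈ oddDegrees l, c m • lowered E F (k + l - m) (2 * l - m) := by
  obtain ⟨P, hPE, hPF⟩ := h.exists_conj h.neg_transpose
  obtain ⟨B, hB⟩ := exists_basis_sl h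
  have hv := h.linearIndependent
  set X := ⁅lowered E F k 0, lowered E F l (2 * l)⁆ with hX
  obtain ⟨x, hx⟩ : ∃ x : Index n → ℂ, X = ∑ p, x p • lowered E F p.1.1 (depth p) := by
    let Y : Sl n := ⟨X, show X.trace = 0 from LieAlgebra.matrix_trace_commutator_zero _ _ _ _⟩
    refine ⟨B.repr Y, ?_⟩
    have h1 := congrArg Subtype.val (B.sum_repr Y)
    rw [← show Y.val = X from rfl, ← h1]
    have h2 := map_sum (LieAlgebra.SpecialLinear.sl (Fin n) ℂ).toSubmodule.subtype
      (fun p => B.repr Y p • B p) Finset.univ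
    refine h2.trans (Finset.sum_congr rfl fun p _ => ?_)
    rw [map_smul, ← hB]
    rfl
  have hweight : ∀ p, x p ≠ 0 → k + depth p = p.1.1 + l := by
    intro p hp
    have h1 := eigenvalue_eq_of_coeff_ne_zero hv (T := toEnd ℂ _ _ H) (x := x)
      (s := 2 * k - 2 * l) (fun p => lie_h_lowered h.triple (depth p)) (by
        rw [← hx, toEnd_apply_apply, hX, leibniz_lie, lie_h_lowered h.triple,
          lie_h_lowered h.triple, smul_lie, lie_smul]
        push_cast
        module) hp
    have h2 : (k : ℂ) + depth p = p.1.1 + l := by linear_combination (-1 / 2 : ℂ) * h1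
    exact_mod_cast h2
  -- `ad_E` commutes with `ad_{E^k}`, so `ad_E^(2l+1)` kills the bracket. Following it by
  -- `ad_F^(2l+1)` gives a diagonal operator, nonzero on vectors of depth above `2l`.
  have hbound : ∀ p, x p ≠ 0 → depth p ≤ 2 * l := by
    intro p hp
    choose t ht ht' using fun p : Index n =>
      exists_pow_toEnd_f_pow_toEnd_e_lowered h.triple p.1.1 (depth p) (2 * l + 1) (depth_le p)
    have h1 := eigenvalue_eq_of_coeff_ne_zero hv (x := x) (s := 0) ht (by
        rw [← hx, Module.End.mul_apply, hX, lowered_zero,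
          toEnd_pow_lie_of_lie_eq_zero (lie_self_pow E k),
          pow_toEnd_e_lowered_eq_zero h.triple le_rfl (Nat.lt_succ_self _), lie_zero, map_zero,
          zero_smul]) hp
    by_contra! h2
    exact ht' p h2 h1
  have hparity : ∀ p, x p ≠ 0 → Odd (k + l + p.1.1) := by
    intro p hp
    have h1 := eigenvalue_eq_of_coeff_ne_zero hv (T := conjTranspose P) (x := x)
      (fun p => conjTranspose_lowered P hPE hPF p.1.1 (depth p))
      (by rw [← hx, conjTranspose_lie_lowered P hPE hPF]) hp
    by_contra h2
    rw [Nat.not_odd_iff_even] at h2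
    have h3 : (-1 : ℂ) ^ (k + l + p.1.1) = 1 := h2.neg_one_pow
    rw [pow_add, h1, pow_succ, mul_neg_one, mul_neg, ← pow_add, ← two_mul, pow_mul] at h3
    norm_num at h3
  -- The substitution is `m = k + l - i`, with `i` the first index; degrees outside the basis get
  -- `0`.
  let c : ℕ → ℂ := fun m => if hm : 1 ≤ k + l - m ∧ k + l - m < n ∧ 2 * l - m ≤ 2 * (k + l - m) then
    x (idx (k + l - m) (2 * l - m) ⟨hm.1, hm.2.1⟩ hm.2.2) else 0
  refine ⟨c, fun m _ hm => dif_neg (by omega), ?_⟩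
  rw [hx]
  have hval : ∀ p, x p ≠ 0 → 1 ≤ k + l - p.1.1 ∧ k + l - p.1.1 ≤ 2 * l - 1 ∧
      p.1.1 < k + l ∧ 2 * l - (k + l - p.1.1) = depth p := by
    intro p hp
    have h1 := hweight p hp
    have h2 := hbound p hp
    obtain ⟨r, hr⟩ := hparity p hp
    have h3 := p.2.1.1
    omega
  have hc : ∀ p, x p ≠ 0 → c (k + l - p.1.1) = x p := by
    intro p hp
    obtain ⟨h1, h2, h3, h4⟩ := hval p hp
    have h5 : k + l - (k + l - p.1.1) = p.1.1 := by omega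
    have h6 := depth_le p
    have h7 := p.2.1
    rw [show c (k + l - p.1.1) = _ from dif_pos ⟨by omega, by omega, by omega⟩]
    congr 1
    refine index_ext h5 ?_
    rw [depth_idx, h4]
  refine Finset.sum_bij_ne_zero (fun p _ _ => k + l - p.1.1) ?_ ?_ ?_ ?_
  · intro p _ hp
    replace hp := left_ne_zero_of_smul hp
    obtain ⟨h1, h2, h3, h4⟩ := hval p hp
    refine mem_oddDegrees.2 ⟨⟨h1, h2⟩, ?_⟩
    have := hparity p hp
    rw [Nat.odd_iff] at this ⊢
    omega
  · intro p _ hp q _ hq hpq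
    replace hp := left_ne_zero_of_smul hp
    replace hq := left_ne_zero_of_smul hq
    have h1 := hval p hp
    have h2 := hval q hq
    have h3 := hweight p hp
    have h4 := hweight q hq
    exact index_ext (by omega) (by omega)
  · intro m hm hcm
    replace hcm := left_ne_zero_of_smul hcm
    have hm' := mem_oddDegrees.1 hm
    by_cases hcond : 1 ≤ k + l - m ∧ k + l - m < n ∧ 2 * l - m ≤ 2 * (k + l - m)
    · have h1 : c m = _ := dif_pos hcond
      rw [h1] at hcm
      refine ⟨_, Finset.mem_univ _, smul_ne_zero hcm (hv.ne_zero _), ?_⟩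
      change k + l - (k + l - m) = m
      omega
    · exact absurd (dif_neg hcond) hcm
  · intro p _ hp
    replace hp := left_ne_zero_of_smul hp
    obtain ⟨h1, h2, h3, h4⟩ := hval p hp
    rw [hc p hp, h4, show k + l - (k + l - p.1.1) = p.1.1 by omega]

/-- The structure constants are the same for all regular triples. -/
theorem exists_structure_constants (n k l : ℕ) (hl : 1 ≤ l) (hlk : l ≤ k) :
    ∃ c : ℕ → ℂ, ∀ E H F : Matrix (Fin n) (Fin n) ℂ, IsRegularTriple E H F →
      (∀ m ∈ oddDegrees l, n ≤ k + l - m → c m = 0) ∧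
      ⁅lowered E F k 0, lowered E F l (2 * l)⁆ =
        ∑ m ∈ oddDegrees l, c m • lowered E F (k + l - m) (2 * l - m) := by
  by_cases hex : ∃ E H F : Matrix (Fin n) (Fin n) ℂ, IsRegularTriple E H F
  · obtain ⟨E₀, H₀, F₀, h₀⟩ := hex
    obtain ⟨c, hc, hc'⟩ := h₀.exists_lie_highest_lowest hl hlk
    refine ⟨c, fun E H F h => ⟨hc, ?_⟩⟩
    obtain ⟨P, hE, hF⟩ := h₀.exists_conj h
    have h1 : SemiconjBy (P : Matrix (Fin n) (Fin n) ℂ)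
        ⁅lowered E₀ F₀ k 0, lowered E₀ F₀ l (2 * l)⁆ ⁅lowered E F k 0, lowered E F l (2 * l)⁆ :=
      semiconjBy_lie (semiconjBy_lowered hE hF _ _) (semiconjBy_lowered hE hF _ _)
    have h2 : SemiconjBy (P : Matrix (Fin n) (Fin n) ℂ)
        (∑ m ∈ oddDegrees l, c m • lowered E₀ F₀ (k + l - m) (2 * l - m))
        (∑ m ∈ oddDegrees l, c m • lowered E F (k + l - m) (2 * l - m)) := by
      change _ * _ = _ * _
      rw [Finset.mul_sum, Finset.sum_mul]
      refine Finset.sum_congr rfl fun m _ => ?_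
      rw [mul_smul_comm, smul_mul_assoc, (semiconjBy_lowered hE hF _ _).eq]
    rw [hc'] at h1
    exact P.mul_left_inj.1 (h1.eq.symm.trans h2.eq)
  · push Not at hex
    -- Without a regular triple to read the constants from, the claim is vacuous.
    exact ⟨0, fun E H F h => absurd h (hex E H F)⟩

end

/-! ### Binary forms and equivariance of transvectants. -/

section

open MvPolynomial

/-- The raising operator `x ∂/∂y`. -/
def raise : Poly →ₗ[ℂ] Poly :=
  LinearMap.mulLeft ℂ (X 0) ∘ₗ (pderiv (R := ℂ) (1 : Fin 2)).toLinearMap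

/-- The lowering operator `y ∂/∂x`. -/
def lower : Poly →ₗ[ℂ] Poly :=
  LinearMap.mulLeft ℂ (X 1) ∘ₗ (pderiv (R := ℂ) (0 : Fin 2)).toLinearMap

theorem raise_apply (P : Poly) : raise P = X 0 * pderiv 1 P := rfl

theorem lower_apply (P : Poly) : lower P = X 1 * pderiv 0 P := rfl

theorem raise_mul (P Q : Poly) : raise (P * Q) = raise P * Q + P * raise Q := by
  simp only [raise_apply, Derivation.leibniz, smul_eq_mul]
  ring

theorem lower_mul (P Q : Poly) : lower (P * Q) = lower P * Q + P * lower Q := by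
  simp only [lower_apply, Derivation.leibniz, smul_eq_mul]
  ring

/-- The action of an operator on a tensor product through the Leibniz rule. -/
def leibnizTensor (T : Poly →ₗ[ℂ] Poly) : Module.End ℂ (Poly ⊗[ℂ] Poly) :=
  TensorProduct.map T LinearMap.id + TensorProduct.map LinearMap.id T

theorem Omega_tmul (P Q : Poly) :
    Omega (P ⊗ₜ[ℂ] Q) = pderiv 0 P ⊗ₜ pderiv 1 Q - pderiv 1 P ⊗ₜ pderiv 0 Q := rfl

theorem leibnizTensor_tmul (T : Poly →ₗ[ℂ] Poly) (P Q : Poly) :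
    leibnizTensor T (P ⊗ₜ[ℂ] Q) = T P ⊗ₜ Q + P ⊗ₜ T Q := rfl

theorem pderiv_comm (i j : Fin 2) (P : Poly) :
    pderiv i (pderiv j P) = pderiv j (pderiv i P) := by
  have h : ⁅pderiv (R := ℂ) i, pderiv (R := ℂ) j⁆ = 0 := by
    refine MvPolynomial.derivation_ext fun k => ?_
    simp [Derivation.commutator_apply, pderiv_X, Pi.single_apply]
    split_ifs <;> simp
  have h2 := DFunLike.congr_fun h P
  rw [Derivation.commutator_apply] at h2
  exact sub_eq_zero.1 h2

theorem pderiv_zero_raise (P : Poly) : pderiv 0 (raise P) = pderiv 1 P + raise (pderiv 0 P) := by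
  rw [raise_apply, raise_apply, Derivation.leibniz, pderiv_X_self, pderiv_comm 0 1]
  simp [add_comm]

theorem pderiv_one_raise (P : Poly) : pderiv 1 (raise P) = raise (pderiv 1 P) := by
  rw [raise_apply, raise_apply, Derivation.leibniz, pderiv_X_of_ne (by decide)]
  simp

theorem pderiv_one_lower (P : Poly) : pderiv 1 (lower P) = pderiv 0 P + lower (pderiv 1 P) := by
  rw [lower_apply, lower_apply, Derivation.leibniz, pderiv_X_self, pderiv_comm 1 0]
  simp [add_comm]

theorem pderiv_zero_lower (P : Poly) : pderiv 0 (lower P) = lower (pderiv 0 P) := by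
  rw [lower_apply, lower_apply, Derivation.leibniz, pderiv_X_of_ne (by decide)]
  simp

/-- The correction terms `∂P/∂y ⊗ ∂Q/∂y` from the two halves of Ω cancel: Ω is sl₂-invariant. -/
theorem commute_Omega_raise : Commute Omega (leibnizTensor raise) := by
  refine TensorProduct.ext' fun P Q => ?_
  simp only [Module.End.mul_apply, Omega_tmul, leibnizTensor_tmul, map_add, map_sub,
    pderiv_zero_raise, pderiv_one_raise, TensorProduct.add_tmul, TensorProduct.tmul_add]
  abel

theorem commute_Omega_lower : Commute Omega (leibnizTensor lower) := by
  refine TensorProduct.ext' fun P Q => ?_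
  simp only [Module.End.mul_apply, Omega_tmul, leibnizTensor_tmul, map_add, map_sub,
    pderiv_zero_lower, pderiv_one_lower, TensorProduct.add_tmul, TensorProduct.tmul_add]
  abel

theorem map_transvectant {T : Poly →ₗ[ℂ] Poly} (hT : ∀ P Q, T (P * Q) = T P * Q + P * T Q)
    (hO : Commute Omega (leibnizTensor T)) (m : ℕ) (P Q : Poly) :
    T (transvectant m P Q) = transvectant m (T P) Q + transvectant m P (T Q) := by
  have h1 : T ∘ₗ LinearMap.mul' ℂ Poly = LinearMap.mul' ℂ Poly ∘ₗ leibnizTensor T := by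
    refine TensorProduct.ext' fun P Q => ?_
    simp [leibnizTensor_tmul, hT]
  have h2 := LinearMap.congr_fun h1 ((Omega ^ m) (P ⊗ₜ[ℂ] Q))
  rw [LinearMap.comp_apply, LinearMap.comp_apply, ← Module.End.mul_apply (leibnizTensor T),
    ← (hO.pow_left m).eq, Module.End.mul_apply, leibnizTensor_tmul, map_add, map_add] at h2
  exact h2

theorem raise_transvectant (m : ℕ) (P Q : Poly) :
    raise (transvectant m P Q) = transvectant m (raise P) Q + transvectant m P (raise Q) :=
  map_transvectant raise_mul commute_Omega_raise m P Q

theorem lower_transvectant (m : ℕ) (P Q : Poly) :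
    lower (transvectant m P Q) = transvectant m (lower P) Q + transvectant m P (lower Q) :=
  map_transvectant lower_mul commute_Omega_lower m P Q

theorem transvectant_comm (m : ℕ) (P Q : Poly) :
    transvectant m Q P = (-1 : ℂ) ^ m • transvectant m P Q := by
  have h1 : ∀ z : Poly ⊗[ℂ] Poly,
      Omega (TensorProduct.comm ℂ Poly Poly z) = -TensorProduct.comm ℂ Poly Poly (Omega z) := by
    intro z
    induction z with
    | zero => simp
    | add x y hx hy => rw [map_add, map_add, hx, hy, map_add, map_add, neg_add]
    | tmul P Q =>
      rw [TensorProduct.comm_tmul, Omega_tmul, Omega_tmul, map_sub, TensorProduct.comm_tmul,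
        TensorProduct.comm_tmul, neg_sub]
  have h2 : ∀ m, (Omega ^ m) (Q ⊗ₜ[ℂ] P) =
      (-1 : ℂ) ^ m • TensorProduct.comm ℂ Poly Poly ((Omega ^ m) (P ⊗ₜ[ℂ] Q)) := by
    intro m
    induction m with
    | zero => simp
    | succ m ih =>
      rw [pow_succ', Module.End.mul_apply, ih, map_smul, h1, Module.End.mul_apply, pow_succ']
      module
  have h3 : ∀ z : Poly ⊗[ℂ] Poly,
      LinearMap.mul' ℂ Poly (TensorProduct.comm ℂ Poly Poly z) = LinearMap.mul' ℂ Poly z := by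
    intro z
    induction z with
    | zero => simp
    | add x y hx hy => rw [map_add, map_add, hx, hy, map_add]
    | tmul P Q => simp [mul_comm]
  rw [transvectant, transvectant, h2, map_smul, h3]

theorem transvectant_smul_left (m : ℕ) (c : ℂ) (P Q : Poly) :
    transvectant m (c • P) Q = c • transvectant m P Q := by
  rw [transvectant, ← TensorProduct.smul_tmul', map_smul, map_smul, transvectant]

theorem transvectant_smul_right (m : ℕ) (c : ℂ) (P Q : Poly) :
    transvectant m P (c • Q) = c • transvectant m P Q := by
  rw [transvectant, TensorProduct.tmul_smul, map_smul, map_smul, transvectant]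

theorem transvectant_zero_left (m : ℕ) (Q : Poly) : transvectant m 0 Q = 0 := by
  rw [transvectant, TensorProduct.zero_tmul, map_zero, map_zero]

theorem transvectant_zero_right (m : ℕ) (P : Poly) : transvectant m P 0 = 0 := by
  rw [transvectant, TensorProduct.tmul_zero, map_zero, map_zero]

/-- Only `∂/∂x ⊗ ∂/∂y` contributes, since `∂/∂y` kills powers of `x`. -/
theorem Omega_pow_monomials (a b : ℕ) {m : ℕ} (ha : m ≤ a) (hb : m ≤ b) :
    (Omega ^ m) ((X 0 ^ a : Poly) ⊗ₜ[ℂ] (X 1 ^ b : Poly)) =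
      ((a.descFactorial m : ℂ) * b.descFactorial m) •
        ((X 0 ^ (a - m) : Poly) ⊗ₜ[ℂ] (X 1 ^ (b - m) : Poly)) := by
  induction m with
  | zero => simp
  | succ m ih =>
    have h0 : ∀ c : ℕ, pderiv 0 (X 0 ^ c : Poly) = (c : ℂ) • X 0 ^ (c - 1) := by
      intro c
      rw [pderiv_pow, pderiv_X_self, mul_one, smul_eq_C_mul, map_natCast]
    have h1 : ∀ c : ℕ, pderiv 1 (X 1 ^ c : Poly) = (c : ℂ) • X 1 ^ (c - 1) := by
      intro c
      rw [pderiv_pow, pderiv_X_self, mul_one, smul_eq_C_mul, map_natCast]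
    have h2 : ∀ c : ℕ, pderiv 1 (X 0 ^ c : Poly) = 0 := by
      intro c
      rw [pderiv_pow, pderiv_X_of_ne (by decide), mul_zero]
    rw [pow_succ', Module.End.mul_apply, ih (by omega) (by omega), map_smul, Omega_tmul, h0, h1,
      h2, TensorProduct.zero_tmul, sub_zero, TensorProduct.smul_tmul_smul, smul_smul,
      Nat.descFactorial_succ, Nat.descFactorial_succ, Nat.sub_sub, Nat.sub_sub]
    push_cast
    ring_nf

/-- The monomial `y^a x^(2k-a) / (2k-a)!`, zero if `a > 2k`. -/
def loweredMon (k a : ℕ) : Poly :=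
  if a ≤ 2 * k then ((2 * k - a).factorial : ℂ)⁻¹ • (X 1 ^ a * X 0 ^ (2 * k - a)) else 0

theorem loweredMon_of_le {k a : ℕ} (h : a ≤ 2 * k) :
    loweredMon k a = ((2 * k - a).factorial : ℂ)⁻¹ • (X 1 ^ a * X 0 ^ (2 * k - a)) := if_pos h

theorem loweredMon_of_lt {k a : ℕ} (h : 2 * k < a) : loweredMon k a = 0 := if_neg (by omega)

theorem mon_eq_loweredMon {n : ℕ} (p : Index n) :
    mon p.1.1 p.1.2 = loweredMon p.1.1 (depth p) := by
  have h1 := cast_depth p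
  have h2 := depth_le p
  have h3 : ((p.1.1 : ℤ) + p.1.2).toNat = 2 * p.1.1 - depth p := by omega
  rw [loweredMon_of_le h2, mon, h3, smul_eq_C_mul, depth]

theorem lower_loweredMon (k a : ℕ) : lower (loweredMon k a) = loweredMon k (a + 1) := by
  rcases lt_trichotomy a (2 * k) with h | rfl | h
  · obtain ⟨r, hr⟩ := Nat.exists_eq_add_of_lt h
    rw [loweredMon_of_le h.le, loweredMon_of_le h, map_smul, lower_apply, Derivation.leibniz,
      pderiv_pow, pderiv_pow, pderiv_X_self, pderiv_X_of_ne (by decide),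
      show 2 * k - a = r + 1 by omega, show 2 * k - (a + 1) = r by omega, Nat.factorial_succ]
    have h2 : ((r : ℂ) + 1) ≠ 0 := Nat.cast_add_one_ne_zero r
    have h3 : (((r + 1) * r.factorial : ℕ) : ℂ)⁻¹ * ((r + 1 : ℕ) : ℂ) = (r.factorial : ℂ)⁻¹ := by
      push_cast
      field_simp
    rw [← h3, mul_smul, Nat.cast_smul_eq_nsmul]
    congr 1
    simp only [smul_eq_mul, mul_zero, add_zero, mul_one, Nat.add_sub_cancel, nsmul_eq_mul,
      Nat.succ_eq_add_one]
    push_cast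
    ring
  · rw [loweredMon_of_le le_rfl, loweredMon_of_lt (Nat.lt_succ_self _), Nat.sub_self, pow_zero,
      mul_one, map_smul, lower_apply, pderiv_pow, pderiv_X_of_ne (by decide), mul_zero, mul_zero,
      smul_zero]
  · rw [loweredMon_of_lt h, loweredMon_of_lt (by omega), map_zero]

theorem raise_loweredMon_zero (k : ℕ) : raise (loweredMon k 0) = 0 := by
  rw [loweredMon_of_le (Nat.zero_le _), pow_zero, one_mul, map_smul, raise_apply, pderiv_pow,
    pderiv_X_of_ne (by decide), mul_zero, mul_zero, smul_zero]

theorem raise_loweredMon_succ {k a : ℕ} (h : a < 2 * k) :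
    raise (loweredMon k (a + 1)) = (((a : ℂ) + 1) * (2 * k - a)) • loweredMon k a := by
  obtain ⟨r, hr⟩ := Nat.exists_eq_add_of_lt h
  have hr' : (2 * k : ℂ) = a + r + 1 := by exact_mod_cast hr
  rw [loweredMon_of_le h.le, loweredMon_of_le h, map_smul, raise_apply, Derivation.leibniz,
    pderiv_pow, pderiv_pow, pderiv_X_self, pderiv_X_of_ne (by decide),
    show 2 * k - a = r + 1 by omega, show 2 * k - (a + 1) = r by omega, Nat.factorial_succ, hr',
    smul_smul]
  have h2 : ((r : ℂ) + 1) ≠ 0 := Nat.cast_add_one_ne_zero r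
  have h3 : ((a : ℂ) + 1) * (a + r + 1 - a) * (((r + 1) * r.factorial : ℕ) : ℂ)⁻¹ =
      (r.factorial : ℂ)⁻¹ * ((a + 1 : ℕ) : ℂ) := by
    push_cast
    field_simp
    ring
  rw [h3, mul_smul, Nat.cast_smul_eq_nsmul]
  congr 1
  simp only [smul_eq_mul, mul_zero, zero_add, mul_one, nsmul_eq_mul]
  push_cast
  ring

/-- The transvectants of a highest and a lowest weight vector are nonzero multiples of monomials. -/
theorem exists_transvectant_highest_lowest {k l m : ℕ} (hlk : l ≤ k) (hm : m ≤ 2 * l) :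
    ∃ d : ℂ, d ≠ 0 ∧ transvectant m (loweredMon k 0) (loweredMon l (2 * l)) =
      d • loweredMon (k + l - m) (2 * l - m) := by
  refine ⟨((2 * k).factorial : ℂ)⁻¹ * (((2 * k).descFactorial m : ℂ) * (2 * l).descFactorial m) *
    ((2 * k - m).factorial : ℂ), ?_, ?_⟩
  · have h1 : ∀ r : ℕ, (r.factorial : ℂ) ≠ 0 := fun r => Nat.cast_ne_zero.2 r.factorial_ne_zero
    have h2 : ∀ r : ℕ, m ≤ r → (r.descFactorial m : ℂ) ≠ 0 := fun r hr =>
      Nat.cast_ne_zero.2 (Nat.descFactorial_eq_zero_iff_lt.not.2 (by omega))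
    exact mul_ne_zero (mul_ne_zero (inv_ne_zero (h1 _)) (mul_ne_zero (h2 _ (by omega))
      (h2 _ hm))) (h1 _)
  · rw [loweredMon_of_le (Nat.zero_le _), loweredMon_of_le le_rfl, transvectant_smul_left,
      transvectant_smul_right, Nat.sub_self, pow_zero, pow_zero, mul_one, one_mul, Nat.sub_zero,
      transvectant, Omega_pow_monomials _ _ (by omega) hm, map_smul, LinearMap.mul'_apply,
      loweredMon_of_le (by omega), show 2 * (k + l - m) - (2 * l - m) = 2 * k - m by omega]
    have h1 : ((2 * k - m).factorial : ℂ) ≠ 0 := Nat.cast_ne_zero.2 (Nat.factorial_ne_zero _)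
    rw [mul_comm (X 0 ^ (2 * k - m) : Poly), smul_smul, smul_smul, smul_smul,
      mul_inv_cancel_right₀ h1]
    simp

end

/-! ### The dictionary between `sl_n` and binary forms. -/

section

open MvPolynomial LieModule

section Dictionary

variable {n : ℕ}

theorem linearIndependent_mon : LinearIndependent ℂ (fun p : Index n => mon p.1.1 p.1.2) := by
  let e : Index n → (Fin 2 →₀ ℕ) := fun p =>
    Finsupp.single 1 ((p.1.1 : ℤ) - p.1.2).toNat + Finsupp.single 0 ((p.1.1 : ℤ) + p.1.2).toNat
  have he : Function.Injective e := by
    intro p q hpq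
    have h0 := DFunLike.congr_fun hpq 0
    have h1 := DFunLike.congr_fun hpq 1
    simp only [e, Finsupp.add_apply, Finsupp.single_apply] at h0 h1
    norm_num at h0 h1
    have hp := p.2.2
    have hq := q.2.2
    refine Subtype.ext (Prod.ext ?_ ?_) <;> omega
  have h := ((basisMonomials (Fin 2) ℂ).linearIndependent.comp e he).units_smul
    (fun p => Units.mk0 ((((p.1.1 : ℤ) + p.1.2).toNat.factorial : ℂ)⁻¹)
      (inv_ne_zero (Nat.cast_ne_zero.2 (Nat.factorial_ne_zero _))))
  have hmon : (fun p : Index n => mon p.1.1 p.1.2) =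
      (fun p : Index n => Units.mk0 ((((p.1.1 : ℤ) + p.1.2).toNat.factorial : ℂ)⁻¹)
        (inv_ne_zero (Nat.cast_ne_zero.2 (Nat.factorial_ne_zero _)))) •
        ((basisMonomials (Fin 2) ℂ) ∘ e) := by
    ext1 p
    simp only [Pi.smul_apply', Function.comp_apply, coe_basisMonomials, Units.smul_mk0]
    rw [mon, X_pow_eq_monomial, X_pow_eq_monomial, monomial_mul, one_mul, smul_eq_C_mul]
  rw [hmon]
  exact h

theorem toPoly_injective (B : Module.Basis (Index n) ℂ (Sl n)) :
    Function.Injective (toPoly B) := by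
  refine (injective_iff_map_eq_zero _).2 fun x hx => ?_
  rw [toPoly, Module.Basis.constr_apply_fintype] at hx
  have h := Fintype.linearIndependent_iff.1 linearIndependent_mon _ hx
  exact B.equivFun.map_eq_zero_iff.1 (funext h)

variable {E H F : Sl n}

/-- The element of `sl_n` with underlying matrix `ad_F^a (E^k)`, for `1 ≤ k`. -/
def slLowered (h : IsRegularTriple (E : Matrix (Fin n) (Fin n) ℂ) H F) (k a : ℕ) : Sl n :=
  if hk : 1 ≤ k then ⟨lowered (E : Matrix (Fin n) (Fin n) ℂ) F k a,
    trace_lowered ⟨n, h.pow_eq_zero⟩ hk a⟩ else 0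

variable (h : IsRegularTriple (E : Matrix (Fin n) (Fin n) ℂ) H F)

theorem coe_slLowered {k : ℕ} (hk : 1 ≤ k) (a : ℕ) :
    (slLowered h k a : Matrix (Fin n) (Fin n) ℂ) = lowered (E : Matrix (Fin n) (Fin n) ℂ) F k a := by
  rw [slLowered, dif_pos hk]

theorem lie_f_slLowered {k : ℕ} (hk : 1 ≤ k) (a : ℕ) :
    ⁅F, slLowered h k a⁆ = slLowered h k (a + 1) := by
  apply Subtype.ext
  rw [LieSubalgebra.coe_bracket, coe_slLowered h hk, coe_slLowered h hk, lie_lowered]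

theorem lie_e_slLowered_zero {k : ℕ} (hk : 1 ≤ k) : ⁅E, slLowered h k 0⁆ = 0 := by
  apply Subtype.ext
  rw [LieSubalgebra.coe_bracket, coe_slLowered h hk, lowered_zero, lie_self_pow]
  rfl

theorem lie_e_slLowered_succ {k : ℕ} (hk : 1 ≤ k) (a : ℕ) :
    ⁅E, slLowered h k (a + 1)⁆ = (((a : ℂ) + 1) * (2 * k - a)) • slLowered h k a := by
  apply Subtype.ext
  rw [LieSubalgebra.coe_bracket, coe_slLowered h hk, lie_e_lowered_succ h.triple,
    ← coe_slLowered h hk]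
  rfl

theorem slLowered_of_lt {k a : ℕ} (hk : 1 ≤ k) (ha : 2 * k < a) : slLowered h k a = 0 := by
  apply Subtype.ext
  rw [coe_slLowered h hk, lowered_eq_zero_of_lt h.triple ha]
  rfl

variable {B : Module.Basis (Index n) ℂ (Sl n)} (hB : ∀ p, B p = slLowered h p.1.1 (depth p))
include hB

theorem toPoly_slLowered {k : ℕ} (hk : 1 ≤ k) (hkn : k < n) (a : ℕ) :
    toPoly B (slLowered h k a) = loweredMon k a := by
  rcases Nat.lt_or_ge (2 * k) a with ha | ha
  · rw [slLowered_of_lt h hk ha, loweredMon_of_lt ha, map_zero]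
  · have h1 := hB (idx k a ⟨hk, hkn⟩ ha)
    rw [depth_idx] at h1
    rw [show slLowered h k a = _ from h1.symm, toPoly, Module.Basis.constr_basis,
      mon_eq_loweredMon, depth_idx]
    rfl

theorem toPoly_lie_f (Z : Sl n) : toPoly B ⁅F, Z⁆ = lower (toPoly B Z) := by
  have h1 : toPoly B ∘ₗ toEnd ℂ (Sl n) (Sl n) F = lower ∘ₗ toPoly B := by
    refine B.ext fun p => ?_
    rw [LinearMap.comp_apply, LinearMap.comp_apply, toEnd_apply_apply, hB,
      lie_f_slLowered h p.2.1.1, toPoly_slLowered h hB p.2.1.1 p.2.1.2,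
      toPoly_slLowered h hB p.2.1.1 p.2.1.2, lower_loweredMon]
  exact LinearMap.congr_fun h1 Z

theorem toPoly_lie_e (Z : Sl n) : toPoly B ⁅E, Z⁆ = raise (toPoly B Z) := by
  have h1 : toPoly B ∘ₗ toEnd ℂ (Sl n) (Sl n) E = raise ∘ₗ toPoly B := by
    refine B.ext fun p => ?_
    rw [LinearMap.comp_apply, LinearMap.comp_apply, toEnd_apply_apply, hB]
    have h2 := depth_le p
    generalize depth p = a at h2 ⊢
    rcases a with _ | a
    · rw [lie_e_slLowered_zero h p.2.1.1, toPoly_slLowered h hB p.2.1.1 p.2.1.2,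
        raise_loweredMon_zero, map_zero]
    · rw [lie_e_slLowered_succ h p.2.1.1, map_smul, toPoly_slLowered h hB p.2.1.1 p.2.1.2,
        toPoly_slLowered h hB p.2.1.1 p.2.1.2, raise_loweredMon_succ (by omega)]
  exact LinearMap.congr_fun h1 Z

/-- An expression of brackets through transvectants extends from the product of a highest and a
lowest weight vector to all products. -/
theorem toPoly_lie_eq_of_highest_lowest {k l : ℕ} (hk : 1 ≤ k) (hl : 1 ≤ l)
    (S : Finset ℕ) (ω : ℕ → ℂ)
    (h0 : toPoly B ⁅slLowered h k 0, slLowered h l (2 * l)⁆ =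
      ∑ m ∈ S, ω m • transvectant m (loweredMon k 0) (loweredMon l (2 * l)))
    (a b : ℕ) :
    toPoly B ⁅slLowered h k a, slLowered h l b⁆ =
      ∑ m ∈ S, ω m • transvectant m (loweredMon k a) (loweredMon l b) := by
  -- The defect of the formula. Raising propagates its vanishing from `(0, 2l)` to all `(0, b)` with
  -- `b ≤ 2l`; lowering then propagates it from `a` to `a + 1`.
  let D : ℕ → ℕ → Poly := fun a b => toPoly B ⁅slLowered h k a, slLowered h l b⁆ -
    ∑ m ∈ S, ω m • transvectant m (loweredMon k a) (loweredMon l b)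
  have hlower : ∀ a b, lower (D a b) = D (a + 1) b + D a (b + 1) := by
    intro a b
    simp only [D, map_sub, map_sum, map_smul, lower_transvectant, lower_loweredMon,
      ← toPoly_lie_f h hB, leibniz_lie F, lie_f_slLowered h hk, lie_f_slLowered h hl, map_add,
      smul_add, Finset.sum_add_distrib]
    abel
  have hraise : ∀ b < 2 * l, raise (D 0 (b + 1)) = (((b : ℂ) + 1) * (2 * l - b)) • D 0 b := by
    intro b hb
    simp only [D, map_sub, map_sum, map_smul, raise_transvectant, raise_loweredMon_zero,
      raise_loweredMon_succ hb, transvectant_zero_left, zero_add, transvectant_smul_right,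
      ← toPoly_lie_e h hB, leibniz_lie E, lie_e_slLowered_zero h hk, lie_e_slLowered_succ h hl,
      zero_lie, lie_smul, smul_sub, Finset.smul_sum]
    congr 1
    exact Finset.sum_congr rfl fun m _ => smul_comm _ _ _
  have hlarge : ∀ a b, 2 * l < b → D a b = 0 := by
    intro a b hb
    simp only [D, slLowered_of_lt h hl hb, loweredMon_of_lt hb, lie_zero, map_zero,
      transvectant_zero_right, smul_zero, Finset.sum_const_zero, sub_zero]
  have hbase : ∀ c ≤ 2 * l, D 0 (2 * l - c) = 0 := by
    intro c
    induction c with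
    | zero => exact fun _ => sub_eq_zero.2 h0
    | succ c ih =>
      intro hc
      have h1 := hraise (2 * l - (c + 1)) (by omega)
      rw [show 2 * l - (c + 1) + 1 = 2 * l - c by omega, ih (by omega), map_zero, eq_comm,
        smul_eq_zero] at h1
      refine h1.resolve_left (mul_ne_zero (Nat.cast_add_one_ne_zero _) (sub_ne_zero.2 ?_))
      norm_cast
      omega
  have hall : ∀ a b, D a b = 0 := by
    intro a
    induction a with
    | zero =>
      intro b
      rcases Nat.lt_or_ge (2 * l) b with hb | hb
      · exact hlarge 0 b hb
      · rw [← Nat.sub_sub_self hb]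
        exact hbase _ (Nat.sub_le _ _)
    | succ a ih =>
      intro b
      have h1 := hlower a b
      rw [ih, ih, map_zero, add_zero] at h1
      exact h1.symm
  exact sub_eq_zero.1 (hall a b)

end Dictionary

/-- The bracket of two basis vectors is a combination of odd transvectants whose coefficients only
depend on the degrees. -/
theorem exists_transvectant_coefficients (n k l : ℕ) (hl : 1 ≤ l) (hlk : l ≤ k) :
    ∃ ω : ℕ → ℂ, ∀ (E H F : Sl n) (h : IsRegularTriple (E : Matrix (Fin n) (Fin n) ℂ) H F)
      (B : Module.Basis (Index n) ℂ (Sl n)), (∀ p, B p = slLowered h p.1.1 (depth p)) →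
      ∀ a b, toPoly B ⁅slLowered h k a, slLowered h l b⁆ =
        ∑ m ∈ oddDegrees l, ω m • transvectant m (loweredMon k a) (loweredMon l b) := by
  obtain ⟨c, hc⟩ := exists_structure_constants n k l hl hlk
  have hd : ∀ m, ∃ d : ℂ, m ≤ 2 * l → d ≠ 0 ∧ transvectant m (loweredMon k 0)
      (loweredMon l (2 * l)) = d • loweredMon (k + l - m) (2 * l - m) := by
    intro m
    by_cases hm : m ≤ 2 * l
    · obtain ⟨d, hd⟩ := exists_transvectant_highest_lowest hlk hm
      exact ⟨d, fun _ => hd⟩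
    · exact ⟨0, fun hm' => absurd hm' hm⟩
  choose d hd using hd
  -- `c m` is the bracket coefficient and `d m` that of the transvectant, both on the highest–lowest
  -- pair.
  refine ⟨fun m => c m / d m, fun E H F h B hB => ?_⟩
  obtain ⟨hc0, hc⟩ := hc _ _ _ h
  have hk : 1 ≤ k := hl.trans hlk
  refine toPoly_lie_eq_of_highest_lowest h hB hk hl _ _ ?_
  have hX : ⁅slLowered h k 0, slLowered h l (2 * l)⁆ =
      ∑ m ∈ oddDegrees l, c m • slLowered h (k + l - m) (2 * l - m) := by
    apply Subtype.ext
    rw [LieSubalgebra.coe_bracket, coe_slLowered h hk, coe_slLowered h hl, hc]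
    symm
    refine (map_sum (LieAlgebra.SpecialLinear.sl (Fin n) ℂ).toSubmodule.subtype _ _).trans
      (Finset.sum_congr rfl fun m hm => ?_)
    have hm' := mem_oddDegrees.1 hm
    rw [map_smul, ← coe_slLowered h (by omega)]
    rfl
  rw [hX, map_sum]
  refine Finset.sum_congr rfl fun m hm => ?_
  have hm' := mem_oddDegrees.1 hm
  obtain ⟨hd0, hd1⟩ := hd m (by omega)
  rw [map_smul, hd1, smul_smul, div_mul_cancel₀ _ hd0]
  -- For `k + l - m ≥ n` the matrix vector is zero but the monomial need not be, so the vanishing of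
  -- `c m` is essential here.
  by_cases hn : n ≤ k + l - m
  · rw [hc0 m hm hn, zero_smul, zero_smul]
  · rw [toPoly_slLowered h hB (by omega) (by omega)]

end

end SlTransvectant

end

theorem theorem1 (n : ℕ) (hn : 2 ≤ n) :
    ∃ ω : ℕ → ℕ → ℕ → ℂ,
      ∀ E H F : SlTransvectant.Sl n, SlTransvectant.IsPrincipalTriple E H F →
        ∃ B : Module.Basis (SlTransvectant.Index n) ℂ (SlTransvectant.Sl n),
          (∀ p : SlTransvectant.Index n,
            (B p : Matrix (Fin n) (Fin n) ℂ) = SlTransvectant.G E F p.1.1 p.1.2) ∧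
          Function.Injective (SlTransvectant.toPoly B) ∧
          ∀ p q : SlTransvectant.Index n,
            SlTransvectant.toPoly B ⁅B p, B q⁆ =
              ∑ m ∈ (Finset.Icc 1 (2 * min p.1.1 q.1.1 - 1)).filter (fun m => Odd m),
                ω (max p.1.1 q.1.1) (min p.1.1 q.1.1) m •
                  SlTransvectant.transvectant m
                    (SlTransvectant.mon p.1.1 p.1.2) (SlTransvectant.mon q.1.1 q.1.2) := by
  have hω : ∀ k l : ℕ, ∃ ω : ℕ → ℂ, 1 ≤ l → l ≤ k → ∀ (E H F : SlTransvectant.Sl n)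
      (h : SlTransvectant.IsRegularTriple (E : Matrix (Fin n) (Fin n) ℂ) H F)
      (B : Module.Basis (SlTransvectant.Index n) ℂ (SlTransvectant.Sl n)),
      (∀ p, B p = SlTransvectant.slLowered h p.1.1 (SlTransvectant.depth p)) →
      ∀ a b, SlTransvectant.toPoly B
        ⁅SlTransvectant.slLowered h k a, SlTransvectant.slLowered h l b⁆ =
        ∑ m ∈ SlTransvectant.oddDegrees l, ω m • SlTransvectant.transvectant m
          (SlTransvectant.loweredMon k a) (SlTransvectant.loweredMon l b) := by
    intro k l
    by_cases hkl : 1 ≤ l ∧ l ≤ k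
    · obtain ⟨ω, hω⟩ :=
        SlTransvectant.exists_transvectant_coefficients n k l hkl.1 hkl.2
      exact ⟨ω, fun _ _ => hω⟩
    · exact ⟨0, fun h1 h2 => absurd ⟨h1, h2⟩ hkl⟩
  choose ω hω using hω
  refine ⟨ω, fun E H F hEHF => ?_⟩
  have h := hEHF.isRegularTriple (by omega)
  obtain ⟨B, hB⟩ := SlTransvectant.exists_basis_sl h
  have hB' : ∀ p, B p = SlTransvectant.slLowered h p.1.1 (SlTransvectant.depth p) := fun p =>
    Subtype.ext (by rw [hB, SlTransvectant.coe_slLowered h p.2.1.1])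
  refine ⟨B, fun p => ?_, SlTransvectant.toPoly_injective B, fun p q => ?_⟩
  · rw [hB, SlTransvectant.G_eq_lowered, SlTransvectant.depth]
  · rw [SlTransvectant.mon_eq_loweredMon, SlTransvectant.mon_eq_loweredMon]
    rcases le_total q.1.1 p.1.1 with hqp | hpq
    · rw [max_eq_left hqp, min_eq_right hqp, hB' p, hB' q]
      exact hω _ _ q.2.1.1 hqp E H F h B hB' _ _
    -- Swapping the arguments negates the bracket and, in odd degree, each transvectant, so the same
    -- constants serve both orders.
    · rw [max_eq_right hpq, min_eq_left hpq, ← lie_skew, map_neg, hB' p, hB' q,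
        hω _ _ p.2.1.1 hpq E H F h B hB' _ _, ← Finset.sum_neg_distrib]
      refine Finset.sum_congr rfl fun m hm => ?_
      rw [SlTransvectant.transvectant_comm, (SlTransvectant.mem_oddDegrees.1 hm).2.neg_one_pow,
        neg_one_smul, smul_neg, neg_neg]
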